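/- Let $n\ge 2$ and let $Q\subset\mathbb R^2$ be a convex $(n+3)$-gon with vertices $q_0,\dots,q_{n+2}$ in counterclockwise order (no three of them collinear). For a triangulation $t$ of $Q$ without new vertices let $v(t)\in\mathbb R^{n+3}$ be its GKZ vector, $v(t)_i=\sum_{\tau\in t,\ q_i\in\tau}\operatorname{area}(\tau)$, and let $\mathrm{GKZ}(Q)=\operatorname{conv}\{v(t): t \text{ a triangulation of } Q\}$ be the secondary polytope (GKZ associahedron) of $Q$. Then: (1) $\mathrm{GKZ}(Q)$ has no pair of parallel facets, i.e. no two different facets with parallel affine hulls. (2) $\mathrm{GKZ}(Q)$ is not normally isomorphic to any Hohlweg--Lange associahedron $\mathrm{Ass}^{I}(\sigma)$, $\sigma\in\{+,-\}^{n-1}$. (3) $\mathrm{GKZ}(Q)$ is not normally isomorphic to any Santos associahedron $\mathrm{Ass}^{II}(T_0)$, $T_0$ a triangulation of the $(n+3)$-gon; that is, its normal fan is not linearly isomorphic to the fan $\mathcal F_{T_0}$, and hence $\mathrm{GKZ}(Q)$ is not normally isomorphic to any polytope whose normal fan is $\mathcal F_{T_0}$ (up to a linear isomorphism). Here two polytopes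 are normally isomorphic if there is a linear isomorphism that carries the cones of the normal fan of one to the cones of the normal fan of the other, where the normal fan of a polytope $P$ is taken in the dual of the linear space parallel to the affine hull of $P$. The associahedron $\mathrm{Ass}^{I}(\sigma)$ is defined as follows. Place vertices $0,1,\dots,n+2$ in convex position from left to right, vertex $k$ in the upper or in the lower chain according to whether the $k$-th sign of $(+,-,\sigma,-,+)$ is $+$ or $-$. For a diagonal $ij$ ($i<j$) of the resulting $(n+3)$-gon let $S_{ij}$ be the set of vertices strictly below it, with $0$ replaced by $i$ and $n+2$ replaced by $j$ if they occur. Then $$\mathrm{Ass}^{I}(\sigma)=\Big\{x\in\mathbb R^{n+1}:\ \sum_{k\in S_{\delta}}x_k\ge\tfrac12|S_\delta|(|S_\delta|+1)\ \text{for all diagonals }\delta,\quad x_1+\dots+x_{n+1}=\tfrac{(n+1)(n+2)}2\Big\}.$$ The fan $\mathcal F_{T_0}$ is defined as follows. Let $\delta_1,\dots,\delta_n$ be the diagonals in $T_0$ and $\alpha_1,\dots,\alpha_n$ a basis of $\mathbb R^n$. Put $v_{\delta_i}=-\alpha_i$, and $v_{\delta}=\sum_{i:\ \delta\text{ crosses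 }\delta_i}\alpha_i$ for every diagonal $\delta\notin T_0$. The cones of $\mathcal F_{T_0}$ are the cones generated by $\{v_\delta:\delta\in D\}$ for all sets $D$ of pairwise non-crossing diagonals; the maximal ones are those of the triangulations. -/

import Mathlib

noncomputable section

namespace Associahedra

open scoped Classical

/-! ### Polytopes, facets, normal fans -/

/-- A polytope: the convex hull of finitely many points. -/
def IsPolytope {E : Type*} [AddCommGroup E] [Module ℝ E] (P : Set E) : Prop :=
  ∃ s : Finset E, P = convexHull ℝ (s : Set E)

/-- The dimension of (the affine hull of) a set. -/
def dimension {E : Type*} [AddCommGroup E] [Module ℝ E] (P : Set E) : ℕ :=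
  Module.finrank ℝ (vectorSpan ℝ P)

/-- `F` is a nonempty face of `P`: the set of maximizers over `P` of some linear functional.
The zero functional gives `P` itself. -/
def IsFace {E : Type*} [AddCommGroup E] [Module ℝ E] (P F : Set E) : Prop :=
  F.Nonempty ∧ ∃ f : Module.Dual ℝ E, F = {x ∈ P | ∀ y ∈ P, f y ≤ f x}

/-- A facet: a face of codimension one in `P`. -/
def IsFacet {E : Type*} [AddCommGroup E] [Module ℝ E] (P F : Set E) : Prop :=
  IsFace P F ∧ dimension F + 1 = dimension P

/-- `F` and `G` form a pair of parallel facets of `P`: they are different facets of `P` whose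
affine hulls are parallel. -/
def IsParallelFacetPair {E : Type*} [AddCommGroup E] [Module ℝ E] (P F G : Set E) : Prop :=
  IsFacet P F ∧ IsFacet P G ∧ F ≠ G ∧ (affineSpan ℝ F).Parallel (affineSpan ℝ G)

/-- The (outer) normal cone of `P` at `F ⊆ P`. It lives in the dual of the linear space parallel to
the affine hull of `P`, in which `P` is full-dimensional; equivalently, functionals on the ambient
space are taken modulo those that are constant on `P`. -/
def normalCone {E : Type*} [AddCommGroup E] [Module ℝ E] (P F : Set E) :
    Set (Module.Dual ℝ (vectorSpan ℝ P)) :=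
  {f | ∀ x y : P, (x : E) ∈ F →
    f ⟨(y : E) -ᵥ (x : E), vsub_mem_vectorSpan ℝ y.2 x.2⟩ ≤ 0}

/-- The normal fan of `P`: the set of the normal cones of all nonempty faces of `P`. -/
def normalFan {E : Type*} [AddCommGroup E] [Module ℝ E] (P : Set E) :
    Set (Set (Module.Dual ℝ (vectorSpan ℝ P))) :=
  {C | ∃ F, IsFace P F ∧ C = normalCone P F}

/-- Two fans (sets of cones) are linearly isomorphic if some linear isomorphism of the ambient
spaces carries the cones of one to the cones of the other. -/
def FansLinearlyIsomorphic {V W : Type*} [AddCommGroup V] [Module ℝ V]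
    [AddCommGroup W] [Module ℝ W] (𝓕 : Set (Set V)) (𝓖 : Set (Set W)) : Prop :=
  ∃ L : V ≃ₗ[ℝ] W, ∀ C : Set V, C ∈ 𝓕 ↔ L '' C ∈ 𝓖

/-- Normal isomorphism of polytopes. -/
def NormallyIsomorphic {E E' : Type*} [AddCommGroup E] [Module ℝ E]
    [AddCommGroup E'] [Module ℝ E'] (P : Set E) (P' : Set E') : Prop :=
  FansLinearlyIsomorphic (normalFan P) (normalFan P')

/-! ### Triangulations of an `(n + 3)`-gon, vertices `0, …, n + 2` in cyclic order -/

/-- The pair of vertices `i < j` is a side of the polygon. -/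
def IsSide {n : ℕ} (i j : Fin (n + 3)) : Prop :=
  (i : ℕ) + 1 = j ∨ ((i : ℕ) = 0 ∧ (j : ℕ) = n + 2)

/-- The diagonals of the `(n + 3)`-gon: pairs of vertices `i < j` that are not sides. -/
abbrev Diagonal (n : ℕ) : Type :=
  {p : Fin (n + 3) × Fin (n + 3) // p.1 < p.2 ∧ ¬ IsSide p.1 p.2}

/-- Two diagonals cross if their end points are four different, interleaving vertices. -/
def Crosses {n : ℕ} (d e : Diagonal n) : Prop :=
  (d.1.1 < e.1.1 ∧ e.1.1 < d.1.2 ∧ d.1.2 < e.1.2) ∨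
  (e.1.1 < d.1.1 ∧ d.1.1 < e.1.2 ∧ e.1.2 < d.1.2)

/-- A set of pairwise non-crossing diagonals. -/
def IsNonCrossing {n : ℕ} (D : Finset (Diagonal n)) : Prop :=
  ∀ d ∈ D, ∀ e ∈ D, ¬ Crosses d e

/-- A triangulation of the polygon (without new vertices), given by its diagonals: a maximal set of
pairwise non-crossing diagonals. -/
def IsTriangulation {n : ℕ} (T : Finset (Diagonal n)) : Prop :=
  IsNonCrossing T ∧ ∀ d : Diagonal n, (∀ e ∈ T, ¬ Crosses d e) → d ∈ T

/-- The triangles of a triangulation `T`: the triples of vertices that are pairwise joined by a side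
of the polygon or by a diagonal of `T`. -/
def triangles {n : ℕ} (T : Finset (Diagonal n)) : Finset (Finset (Fin (n + 3))) :=
  Finset.univ.filter fun σ => σ.card = 3 ∧
    ∀ i ∈ σ, ∀ j ∈ σ, i < j → IsSide i j ∨ ∃ d ∈ T, d.1 = (i, j)

/-! ### The secondary polytope of a convex polygon -/

/-- `q 0, …, q (n + 2)` are the vertices, in counterclockwise order, of a convex `(n + 3)`-gon:
every triple of them, taken in this order, is positively oriented. -/
def IsConvexPolygon {n : ℕ} (q : Fin (n + 3) → EuclideanSpace ℝ (Fin 2)) : Prop :=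
  ∀ i j k : Fin (n + 3), i < j → j < k →
    0 < (q j 0 - q i 0) * (q k 1 - q i 1) - (q j 1 - q i 1) * (q k 0 - q i 0)

/-- The GKZ vector of a triangulation `T` of the polygon with vertices `q`: its coordinate at a
vertex is the total area of the triangles of `T` at that vertex. -/
def gkzVector {n : ℕ} (q : Fin (n + 3) → EuclideanSpace ℝ (Fin 2)) (T : Finset (Diagonal n)) :
    Fin (n + 3) → ℝ :=
  fun a => ∑ σ ∈ (triangles T).filter (fun σ => a ∈ σ),
    (MeasureTheory.volume (convexHull ℝ (q '' (σ : Set (Fin (n + 3)))))).toReal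

/-- The secondary polytope (Gelfand--Kapranov--Zelevinsky associahedron) of the polygon with
vertices `q`. -/
def gkzAssociahedron {n : ℕ} (q : Fin (n + 3) → EuclideanSpace ℝ (Fin 2)) :
    Set (Fin (n + 3) → ℝ) :=
  convexHull ℝ {v | ∃ T : Finset (Diagonal n), IsTriangulation T ∧ v = gkzVector q T}

/-! ### Hohlweg--Lange associahedra -/

/-- The extended sign sequence `+, -, σ, -, +` on the vertices `0, …, n + 2`
(`true` stands for `+`). -/
def hlSign {n : ℕ} (σ : Fin (n - 1) → Bool) (k : Fin (n + 3)) : Bool :=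
  if h : 2 ≤ (k : ℕ) ∧ (k : ℕ) ≤ n then σ ⟨(k : ℕ) - 2, by omega⟩
  else decide ((k : ℕ) = 0 ∨ (k : ℕ) = n + 2)

/-- The second coordinate of vertex `k`, which is placed at the point `(k, hlHeight σ k)`.
Positive vertices lie on a concave arc above the horizontal axis and negative ones on its mirror
image below, so that the vertices are in convex position from left to right. -/
def hlHeight {n : ℕ} (σ : Fin (n - 1) → Bool) (k : Fin (n + 3)) : ℝ :=
  (if hlSign σ k then 1 else -1) * (1 + (k : ℝ) * ((n : ℝ) + 2 - (k : ℝ)))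

/-- For `i < j`, this is negative, zero or positive according to whether vertex `k` lies strictly
below, on, or strictly above the line through the vertices `i` and `j`. -/
def hlOffset {n : ℕ} (σ : Fin (n - 1) → Bool) (i j k : Fin (n + 3)) : ℝ :=
  (hlHeight σ k - hlHeight σ i) * ((j : ℝ) - (i : ℝ)) -
    (hlHeight σ j - hlHeight σ i) * ((k : ℝ) - (i : ℝ))

/-- `ij` with `i < j` is a diagonal (not a side) of the polygon: it has vertices on both sides. -/
def IsHLDiagonal {n : ℕ} (σ : Fin (n - 1) → Bool) (i j : Fin (n + 3)) : Prop :=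
  i < j ∧ (∃ k, hlOffset σ i j k < 0) ∧ (∃ k, 0 < hlOffset σ i j k)

/-- The set of vertices strictly below the diagonal `ij`. -/
def hlBelow {n : ℕ} (σ : Fin (n - 1) → Bool) (i j : Fin (n + 3)) : Finset (Fin (n + 3)) :=
  Finset.univ.filter fun k => hlOffset σ i j k < 0

/-- The set of vertices strictly below `ij`, with `0` replaced by `i` and `n + 2` replaced by `j`
whenever they occur. All its elements are among `1, …, n + 1`. -/
def hlSet {n : ℕ} (σ : Fin (n - 1) → Bool) (i j : Fin (n + 3)) : Finset (Fin (n + 3)) :=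
  (hlBelow σ i j \ {0, Fin.last (n + 2)}) ∪
    (if 0 ∈ hlBelow σ i j then {i} else ∅) ∪
    (if Fin.last (n + 2) ∈ hlBelow σ i j then {j} else ∅)

/-- The Hohlweg--Lange associahedron of `σ`. The coordinate `x m` with `m : Fin (n + 1)` is the one
of label `m + 1`, so that the labels of the coordinates are `1, …, n + 1`. -/
def hlAssociahedron {n : ℕ} (σ : Fin (n - 1) → Bool) : Set (Fin (n + 1) → ℝ) :=
  {x | (∀ i j : Fin (n + 3), IsHLDiagonal σ i j →
      ((hlSet σ i j).card : ℝ) * (((hlSet σ i j).card : ℝ) + 1) / 2 ≤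
        ∑ m ∈ Finset.univ.filter (fun m : Fin (n + 1) => m.succ.castSucc ∈ hlSet σ i j), x m) ∧
    ∑ m, x m = ((n : ℝ) + 1) * ((n : ℝ) + 2) / 2}

/-! ### Santos associahedra -/

/-- The vector of the diagonal `d` with respect to the seed triangulation `T₀`, written in
coordinates for the basis `α` indexed by the diagonals of `T₀`: it is `-α d` if `d ∈ T₀`, and
otherwise the sum of the `α e` over the `e ∈ T₀` that `d` crosses. -/
def santosVector {n : ℕ} (T₀ : Finset (Diagonal n)) (d : Diagonal n) :
    {e : Diagonal n // e ∈ T₀} → ℝ :=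
  fun e => if d ∈ T₀ then (if d = e.1 then -1 else 0) else (if Crosses d e.1 then 1 else 0)

/-- The cone generated by the vectors of the diagonals in `D`. -/
def santosCone {n : ℕ} (T₀ D : Finset (Diagonal n)) : Set ({e : Diagonal n // e ∈ T₀} → ℝ) :=
  {x | ∃ c : Diagonal n → ℝ, (∀ d, 0 ≤ c d) ∧ x = ∑ d ∈ D, c d • santosVector T₀ d}

/-- The fan of the seed triangulation `T₀`. Its maximal cones are those of the triangulations, and
their faces are the cones of the sets of pairwise non-crossing diagonals. -/
def santosFan {n : ℕ} (T₀ : Finset (Diagonal n)) :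
    Set (Set ({e : Diagonal n // e ∈ T₀} → ℝ)) :=
  {C | ∃ D : Finset (Diagonal n), IsNonCrossing D ∧ C = santosCone T₀ D}

/-- A Santos associahedron with seed `T₀`: any polytope whose normal fan is the fan of `T₀`, up to
the identification of the ambient vector spaces. -/
def IsSantosAssociahedron {n : ℕ} (T₀ : Finset (Diagonal n)) {E : Type*} [AddCommGroup E]
    [Module ℝ E] (P : Set E) : Prop :=
  IsPolytope P ∧ FansLinearlyIsomorphic (normalFan P) (santosFan T₀)

end Associahedra

end

noncomputable section

namespace Associahedra

open scoped Classical

/-! ### Combinatorics of triangulations -/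

/-! The invariant behind all three claims is a pair of opposite rays in the normal fan. Linear
isomorphisms of fans preserve such pairs (`FansLinearlyIsomorphic.hasOppositeRays_iff`), and
parallel facets have opposite normals. So it suffices that the fan of GKZ(Q) has no opposite rays
while the other two fans do.

Up to a positive constant, pairing v(t) with a height function w integrates over Q the interpolation
of w that is linear on each triangle of t. For the convex function `bend q d` = max(0, ℓ), with ℓ
vanishing on the line of d, the interpolation lies above the function, and the integrals agree iff d
∈ t (`weightedArea_bend_of_mem`, `minBendArea_lt`). The integrals enter only algebraically, as sums
of a coboundary over the triangles. Relative to a triangulation T every height is an affine function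
plus a combination of the bends of the diagonals of T (`bentHeights_eq_top`), and flips reveal the
signs of the coefficients. Hence every ray of the fan of GKZ(Q) is spanned by some −bend d modulo
affine functions (`exists_bend_of_isRayFunctional`).

Opposite rays would make r · bend d + s · bend e affine for some r > 0, s ≥ 0. In a polygon with at
least five vertices, some three vertices lie on one side of d and also on one side of e. Subtracting
from each bend its supporting affine function at these vertices leaves a nonnegative, not
identically zero function that is affine and vanishes at three non-collinear points, which is absurd
(`bend_combination_ne_affineHeight`).

In the Santos fan, flipping d in the seed yields a diagonal that crosses only d, so its vector is
opposite to that of d. In the Hohlweg–Lange associahedron, 1 ≤ x₁ ≤ n + 1, and both bounds define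
facets, as is seen from relative interior points of the corresponding facets of the permutahedron.
-/

/-- The vertices `i` and `j` are joined by a side of the polygon or by a diagonal of `T`. -/
def IsEdge {n : ℕ} (T : Finset (Diagonal n)) (i j : Fin (n + 3)) : Prop :=
  IsSide i j ∨ ∃ d ∈ T, d.1 = (i, j)

/-- Sides cross nothing. Only one interleaving is excluded; the other follows by exchanging the two
edges. Collecting such instances turns planarity arguments into linear arithmetic on indices. -/
lemma IsEdge.not_cross {n : ℕ} {T : Finset (Diagonal n)} (hT : IsNonCrossing T)
    {a b c e : Fin (n + 3)} (h₁ : IsEdge T a b) (h₂ : IsEdge T c e) :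
    ¬ (a < c ∧ c < b ∧ b < e) := by
  rintro ⟨h, h', h''⟩
  have := e.2
  rcases h₁ with h₁ | ⟨d, hd, hd'⟩
  · rcases h₁ with h₁ | h₁ <;> omega
  rcases h₂ with h₂ | ⟨f, hf, hf'⟩
  · rcases h₂ with h₂ | h₂ <;> omega
  refine hT d hd f hf (Or.inl ?_)
  rw [hd', hf']
  exact ⟨h, h', h''⟩

lemma isEdge_of_mem {n : ℕ} {T : Finset (Diagonal n)} {d : Diagonal n} (hd : d ∈ T) :
    IsEdge T d.1.1 d.1.2 :=
  Or.inr ⟨d, hd, rfl⟩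

lemma isEdge_succ {n : ℕ} (T : Finset (Diagonal n)) {i j : Fin (n + 3)}
    (h : (i : ℕ) + 1 = j) : IsEdge T i j :=
  Or.inl (Or.inl h)

lemma isEdge_zero_last {n : ℕ} (T : Finset (Diagonal n)) :
    IsEdge T 0 (Fin.last (n + 2)) :=
  Or.inl (Or.inr ⟨rfl, rfl⟩)

lemma not_crosses_self {n : ℕ} (d : Diagonal n) : ¬ Crosses d d := by
  rintro (⟨h, -, -⟩ | ⟨h, -, -⟩) <;> exact lt_irrefl _ h

lemma Crosses.symm {n : ℕ} {d e : Diagonal n} (h : Crosses d e) : Crosses e d :=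
  Or.symm h

/-- A pair of vertices that no edge of a triangulation crosses is an edge. -/
lemma IsTriangulation.isEdge {n : ℕ} {T : Finset (Diagonal n)} (hT : IsTriangulation T)
    {i j : Fin (n + 3)} (hij : i < j)
    (h : ∀ a b, IsEdge T a b → ¬ (a < i ∧ i < b ∧ b < j) ∧ ¬ (i < a ∧ a < j ∧ j < b)) :
    IsEdge T i j := by
  by_cases hs : IsSide i j
  · exact Or.inl hs
  refine Or.inr ⟨⟨(i, j), hij, hs⟩, hT.2 _ fun e he hc => ?_, rfl⟩
  have := h _ _ (isEdge_of_mem he)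
  rcases hc with hc | hc
  · exact this.2 hc
  · exact this.1 hc

/-- The third vertex of the triangle on the inner side of an edge. -/
lemma IsTriangulation.exists_apex {n : ℕ} {T : Finset (Diagonal n)} (hT : IsTriangulation T)
    {i j : Fin (n + 3)} (hij : (i : ℕ) + 1 < j) (he : IsEdge T i j) :
    ∃ k, i < k ∧ k < j ∧ IsEdge T i k ∧ IsEdge T k j := by
  have hj := j.2
  -- The apex is the largest neighbour of `i` before `j`. An edge crossing `kj` would cross `ij` or
  -- `ik`, or join `i` to a larger neighbour.
  let s : Finset (Fin (n + 3)) := Finset.univ.filter fun k => i < k ∧ k < j ∧ IsEdge T i k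
  have hs : s.Nonempty := by
    refine ⟨⟨i + 1, by omega⟩, ?_⟩
    simp only [s, Finset.mem_filter, Finset.mem_univ, true_and, Fin.lt_def]
    exact ⟨by omega, by omega, isEdge_succ T rfl⟩
  obtain ⟨k, hk, hmax⟩ := s.exists_max_image id hs
  simp only [s, Finset.mem_filter, Finset.mem_univ, true_and, id] at hk hmax
  obtain ⟨hik, hkj, hek⟩ := hk
  refine ⟨k, hik, hkj, hek, hT.isEdge hkj fun a b hab => ⟨?_, ?_⟩⟩
  · rintro ⟨h1, h2, h3⟩
    have c1 := IsEdge.not_cross hT.1 hab he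
    have c2 := IsEdge.not_cross hT.1 hek hab
    have hai : a = i := by omega
    subst hai
    have := hmax b ⟨by omega, h3, hab⟩
    omega
  · rintro ⟨h1, h2, h3⟩
    exact IsEdge.not_cross hT.1 he hab ⟨by omega, h2, h3⟩

/-- The third vertex of the triangle on the outer side of an edge. -/
lemma IsTriangulation.exists_outer_apex {n : ℕ} {T : Finset (Diagonal n)}
    (hT : IsTriangulation T) {i j : Fin (n + 3)} (hij : i < j) (he : IsEdge T i j)
    (hne : ¬ ((i : ℕ) = 0 ∧ (j : ℕ) = n + 2)) :
    ∃ l, (l < i ∧ IsEdge T l i ∧ IsEdge T l j) ∨ (j < l ∧ IsEdge T i l ∧ IsEdge T j l) := by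
  -- Among the edges other than `ij` that span `[i, j]`, take a shortest one. Its inner apex cannot
  -- lie strictly between `i` and `j`, so one of the two new edges still spans `[i, j]`, and by
  -- minimality it is `ij`.
  let s : Finset (Fin (n + 3) × Fin (n + 3)) := Finset.univ.filter fun p =>
    p.1 ≤ i ∧ j ≤ p.2 ∧ p ≠ (i, j) ∧ IsEdge T p.1 p.2
  have hs : s.Nonempty := by
    refine ⟨(0, Fin.last _), ?_⟩
    simp only [s, Finset.mem_filter, Finset.mem_univ, true_and]
    refine ⟨Fin.zero_le _, Fin.le_last _, ?_, isEdge_zero_last T⟩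
    rintro h
    rw [Prod.mk.injEq] at h
    exact hne ⟨by rw [← h.1]; rfl, by rw [← h.2]; rfl⟩
  obtain ⟨⟨a, b⟩, hab, hmin⟩ := s.exists_min_image (fun p => (p.2 : ℕ) - (p.1 : ℕ)) hs
  simp only [s, Finset.mem_filter, Finset.mem_univ, true_and, Prod.forall, ne_eq,
    Prod.mk.injEq] at hab hmin
  obtain ⟨hai, hjb, hne', heab⟩ := hab
  obtain ⟨m, ham, hmb, eam, emb⟩ := hT.exists_apex (by omega) heab
  have c1 := IsEdge.not_cross hT.1 eam he
  have c2 := IsEdge.not_cross hT.1 he emb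
  have c3 := IsEdge.not_cross hT.1 he eam
  have c4 := IsEdge.not_cross hT.1 emb he
  have hm : m ≤ i ∨ j ≤ m := by omega
  rcases hm with hm | hm
  · by_cases h : m = i ∧ b = j
    · obtain ⟨rfl, rfl⟩ := h
      exact ⟨a, Or.inl ⟨ham, eam, heab⟩⟩
    · have := hmin m b ⟨hm, hjb, h, emb⟩
      omega
  · by_cases h : a = i ∧ m = j
    · obtain ⟨rfl, rfl⟩ := h
      exact ⟨b, Or.inr ⟨hmb, heab, emb⟩⟩
    · have := hmin a m ⟨hai, hm, h, eam⟩
      omega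

/-- Every diagonal of a triangulation is the only one that is crossed by some other diagonal. -/
lemma IsTriangulation.exists_flip {n : ℕ} {T : Finset (Diagonal n)} (hT : IsTriangulation T)
    {d : Diagonal n} (hd : d ∈ T) : ∃ d', Crosses d' d ∧ ∀ e ∈ T, Crosses d' e → e = d := by
  obtain ⟨⟨⟨i, j⟩, hij, hs⟩, rfl⟩ : ∃ d₀, d = d₀ := ⟨d, rfl⟩
  have he := isEdge_of_mem hd
  simp only [IsSide, not_or] at hij hs he
  have hj := j.2
  obtain ⟨k, hik, hkj, eik, ekj⟩ := hT.exists_apex (by omega) he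
  obtain ⟨l, ⟨hl, eli, elj⟩ | ⟨hl, eil, ejl⟩⟩ := hT.exists_outer_apex hij he hs.2
  -- The two triangles at `d` form a quadrilateral, and `lk` is its other diagonal. An edge of `T`
  -- that crosses `lk` without being `d` would cross a side of the quadrilateral.
  · refine ⟨⟨(l, k), hl.trans hik, ?_⟩, Or.inl ⟨hl, hik, hkj⟩, ?_⟩
    · simp only [IsSide]; omega
    rintro ⟨⟨a, b⟩, hab⟩ hmem hc
    have eab := isEdge_of_mem hmem
    simp only [Crosses] at hc eab
    have := IsEdge.not_cross hT.1 eab eli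
    have := IsEdge.not_cross hT.1 eab elj
    have := IsEdge.not_cross hT.1 eab eik
    have := IsEdge.not_cross hT.1 eab ekj
    have := IsEdge.not_cross hT.1 eli eab
    have := IsEdge.not_cross hT.1 elj eab
    have := IsEdge.not_cross hT.1 eik eab
    have := IsEdge.not_cross hT.1 ekj eab
    simp only [Subtype.mk.injEq, Prod.mk.injEq]
    omega
  · refine ⟨⟨(k, l), hkj.trans hl, ?_⟩, Or.inr ⟨hik, hkj, hl⟩, ?_⟩
    · simp only [IsSide]; omega
    rintro ⟨⟨a, b⟩, hab⟩ hmem hc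
    have eab := isEdge_of_mem hmem
    simp only [Crosses] at hc eab
    have := IsEdge.not_cross hT.1 eab eil
    have := IsEdge.not_cross hT.1 eab ejl
    have := IsEdge.not_cross hT.1 eab eik
    have := IsEdge.not_cross hT.1 eab ekj
    have := IsEdge.not_cross hT.1 eil eab
    have := IsEdge.not_cross hT.1 ejl eab
    have := IsEdge.not_cross hT.1 eik eab
    have := IsEdge.not_cross hT.1 ekj eab
    simp only [Subtype.mk.injEq, Prod.mk.injEq]
    omega

lemma IsNonCrossing.exists_isTriangulation {n : ℕ} {D : Finset (Diagonal n)}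
    (hD : IsNonCrossing D) : ∃ T, IsTriangulation T ∧ D ⊆ T := by
  obtain ⟨T, hDT, hT⟩ := (Set.toFinite {T : Finset (Diagonal n) | IsNonCrossing T}).exists_le_maximal
    hD
  refine ⟨T, ⟨hT.prop, fun d hd => ?_⟩, hDT⟩
  have hins : IsNonCrossing (insert d T) := by
    intro a ha b hb
    rw [Finset.mem_insert] at ha hb
    rcases ha with rfl | ha <;> rcases hb with rfl | hb
    · exact not_crosses_self _
    · exact hd b hb
    · exact fun h => hd a ha h.symm
    · exact hT.prop a ha b hb
  exact hT.le_of_ge hins (Finset.subset_insert d T) (Finset.mem_insert_self d T)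

lemma exists_isTriangulation (n : ℕ) : ∃ T : Finset (Diagonal n), IsTriangulation T := by
  obtain ⟨T, hT, -⟩ := IsNonCrossing.exists_isTriangulation (n := n) (D := ∅) (by simp [IsNonCrossing])
  exact ⟨T, hT⟩

/-- The triangulation obtained by a flip at `d`. -/
lemma IsTriangulation.exists_flipped {n : ℕ} {T : Finset (Diagonal n)} (hT : IsTriangulation T)
    {d : Diagonal n} (hd : d ∈ T) :
    ∃ T', IsTriangulation T' ∧ d ∉ T' ∧ ∀ e ∈ T, e ≠ d → e ∈ T' := by
  obtain ⟨d', hc, hu⟩ := hT.exists_flip hd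
  obtain ⟨T', hT', hsub⟩ := IsNonCrossing.exists_isTriangulation (D := insert d' (T.erase d)) (by
    intro a ha b hb hab
    rw [Finset.mem_insert, Finset.mem_erase] at ha hb
    rcases ha with rfl | ha <;> rcases hb with rfl | hb
    · exact not_crosses_self _ hab
    · exact hb.1 (hu b hb.2 hab)
    · exact ha.1 (hu a ha.2 hab.symm)
    · exact hT.1 a ha.2 b hb.2 hab)
  refine ⟨T', hT', fun h => hT'.1 d' (hsub (Finset.mem_insert_self _ _)) d h hc, fun e he hne => ?_⟩
  exact hsub (Finset.mem_insert_of_mem (Finset.mem_erase.2 ⟨hne, he⟩))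

/-! ### Sums over triangles and coboundaries -/

/-- The triangles of a triangulation, as increasing triples. -/
def orderedTriangles {n : ℕ} (T : Finset (Diagonal n)) :
    Finset (Fin (n + 3) × Fin (n + 3) × Fin (n + 3)) :=
  Finset.univ.filter fun t => t.1 < t.2.1 ∧ t.2.1 < t.2.2 ∧
    IsEdge T t.1 t.2.1 ∧ IsEdge T t.2.1 t.2.2 ∧ IsEdge T t.1 t.2.2

lemma mem_orderedTriangles {n : ℕ} {T : Finset (Diagonal n)} {a b c : Fin (n + 3)} :
    (a, b, c) ∈ orderedTriangles T ↔
      a < b ∧ b < c ∧ IsEdge T a b ∧ IsEdge T b c ∧ IsEdge T a c := by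
  simp [orderedTriangles]

lemma sum_triangles {n : ℕ} (T : Finset (Diagonal n)) (G : Finset (Fin (n + 3)) → ℝ) :
    ∑ σ ∈ triangles T, G σ = ∑ t ∈ orderedTriangles T, G {t.1, t.2.1, t.2.2} := by
  symm
  refine Finset.sum_nbij (fun t => {t.1, t.2.1, t.2.2}) ?_ ?_ ?_ fun _ _ => rfl
  · rintro ⟨a, b, c⟩ h
    obtain ⟨hab, hbc, eab, ebc, eac⟩ := mem_orderedTriangles.1 h
    simp only [triangles, Finset.mem_filter, Finset.mem_univ, true_and]
    refine ⟨Finset.card_eq_three.2 ⟨a, b, c, hab.ne, (hab.trans hbc).ne, hbc.ne, rfl⟩, ?_⟩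
    intro i hi j hj hij
    simp only [Finset.mem_insert, Finset.mem_singleton] at hi hj
    rcases hi with rfl | rfl | rfl <;> rcases hj with rfl | rfl | rfl <;>
      first | assumption | (exfalso; omega)
  · rintro ⟨a, b, c⟩ h ⟨a', b', c'⟩ h' heq
    obtain ⟨hab, hbc, -⟩ := mem_orderedTriangles.1 h
    obtain ⟨hab', hbc', -⟩ := mem_orderedTriangles.1 h'
    simp only [Finset.ext_iff, Finset.mem_insert, Finset.mem_singleton] at heq
    have h1 := (heq a).1 (by simp)
    have h2 := (heq b).1 (by simp)
    have h3 := (heq c).1 (by simp)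
    have h4 := (heq a').2 (by simp)
    have h5 := (heq c').2 (by simp)
    simp only [Prod.mk.injEq]
    omega
  · intro σ hσ
    simp only [triangles, Finset.coe_filter, Finset.mem_univ, true_and, Set.mem_ofPred_eq] at hσ
    obtain ⟨hcard, hσ⟩ := hσ
    let f := σ.orderEmbOfFin hcard
    have hf : ∀ k, f k ∈ σ := σ.orderEmbOfFin_mem hcard
    have h01 : f 0 < f 1 := f.strictMono (by decide)
    have h12 : f 1 < f 2 := f.strictMono (by decide)
    refine ⟨(f 0, f 1, f 2), ?_, ?_⟩
    · rw [Finset.mem_coe, mem_orderedTriangles]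
      exact ⟨h01, h12, hσ _ (hf _) _ (hf _) h01, hσ _ (hf _) _ (hf _) h12,
        hσ _ (hf _) _ (hf _) (h01.trans h12)⟩
    · refine Finset.eq_of_subset_of_card_le ?_ ?_
      · simp [Finset.insert_subset_iff, hf]
      · rw [hcard, Finset.card_eq_three.2 ⟨f 0, f 1, f 2, h01.ne, (h01.trans h12).ne, h12.ne, rfl⟩]

/-- The sum of `h` over the pair of the vertices `k` and `k + 1`. -/
def sideValue {n : ℕ} (h : Fin (n + 3) → Fin (n + 3) → ℝ) (k : ℕ) : ℝ :=
  if hk : k + 1 < n + 3 then h ⟨k, by omega⟩ ⟨k + 1, hk⟩ else 0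

lemma IsTriangulation.sum_coboundary_aux {n : ℕ} {T : Finset (Diagonal n)}
    (hT : IsTriangulation T) (h : Fin (n + 3) → Fin (n + 3) → ℝ) (m : ℕ) :
    ∀ i j : Fin (n + 3), i < j → (j : ℕ) - i ≤ m → IsEdge T i j →
    ∑ t ∈ (orderedTriangles T).filter (fun t => i ≤ t.1 ∧ t.2.2 ≤ j),
      (h t.1 t.2.1 + h t.2.1 t.2.2 - h t.1 t.2.2) =
    ∑ k ∈ Finset.Ico (i : ℕ) j, sideValue h k - h i j := by
  induction m with
  | zero => intro i j hij hm; omega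
  | succ m ih =>
    intro i j hij hm he
    have hj := j.2
    by_cases hs : (i : ℕ) + 1 = j
    · rw [Finset.filter_eq_empty_iff.2, Finset.sum_empty, ← hs, Nat.Ico_succ_singleton,
        Finset.sum_singleton, sideValue, dif_pos (by omega)]
      · have : (⟨(i : ℕ) + 1, by omega⟩ : Fin (n + 3)) = j := Fin.ext hs
        rw [this]; simp
      · rintro ⟨a, b, c⟩ ht
        obtain ⟨hab, hbc, -⟩ := mem_orderedTriangles.1 ht
        simp only
        omega
    obtain ⟨k, hik, hkj, eik, ekj⟩ := hT.exists_apex (by omega) he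
    -- No edge crosses `ik` or `kj`, so apart from `(i, k, j)` each triangle inside `[i, j]` lies
    -- over one of these shorter edges. The values of `h` on the two edges then cancel.
    have key : (orderedTriangles T).filter (fun t => i ≤ t.1 ∧ t.2.2 ≤ j) =
        insert (i, k, j) ((orderedTriangles T).filter (fun t => i ≤ t.1 ∧ t.2.2 ≤ k) ∪
          (orderedTriangles T).filter (fun t => k ≤ t.1 ∧ t.2.2 ≤ j)) := by
      ext ⟨a, b, c⟩
      simp only [Finset.mem_filter, Finset.mem_insert, Finset.mem_union, mem_orderedTriangles,
        Prod.mk.injEq]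
      constructor
      · rintro ⟨⟨hab, hbc, eab, ebc, eac⟩, hia, hcj⟩
        have := IsEdge.not_cross hT.1 eik eac
        have := IsEdge.not_cross hT.1 eac ekj
        have := IsEdge.not_cross hT.1 eik ebc
        have := IsEdge.not_cross hT.1 eab ekj
        by_cases h1 : c ≤ k
        · exact Or.inr (Or.inl ⟨⟨hab, hbc, eab, ebc, eac⟩, hia, h1⟩)
        by_cases h2 : k ≤ a
        · exact Or.inr (Or.inr ⟨⟨hab, hbc, eab, ebc, eac⟩, h2, hcj⟩)
        left
        omega
      · rintro (⟨rfl, rfl, rfl⟩ | ⟨h1, h2, h3⟩ | ⟨h1, h2, h3⟩)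
        · exact ⟨⟨hik, hkj, eik, ekj, he⟩, le_rfl, le_rfl⟩
        · exact ⟨h1, h2, by omega⟩
        · exact ⟨h1, by omega, h3⟩
    rw [key, Finset.sum_insert, Finset.sum_union, ih i k hik (by omega) eik,
      ih k j hkj (by omega) ekj,
      ← Finset.sum_Ico_consecutive (sideValue h) (by omega : (i : ℕ) ≤ k) (by omega : (k : ℕ) ≤ j)]
    · ring
    · rw [Finset.disjoint_left]
      rintro ⟨a, b, c⟩ h1 h2
      simp only [Finset.mem_filter, mem_orderedTriangles] at h1 h2
      omega
    · simp only [Finset.mem_union, Finset.mem_filter]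
      omega

/-- The sum of a coboundary over the triangles of a triangulation is a sum over the boundary of
the polygon. -/
lemma IsTriangulation.sum_coboundary {n : ℕ} {T : Finset (Diagonal n)}
    (hT : IsTriangulation T) (h : Fin (n + 3) → Fin (n + 3) → ℝ) :
    ∑ t ∈ orderedTriangles T, (h t.1 t.2.1 + h t.2.1 t.2.2 - h t.1 t.2.2) =
    ∑ k ∈ Finset.range (n + 2), sideValue h k - h 0 (Fin.last (n + 2)) := by
  have := hT.sum_coboundary_aux h (n + 2) 0 (Fin.last (n + 2)) (Fin.last_pos)
    (by simp) (isEdge_zero_last T)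
  have hall : (orderedTriangles T).filter (fun t => 0 ≤ t.1 ∧ t.2.2 ≤ Fin.last (n + 2)) =
      orderedTriangles T :=
    Finset.filter_true_of_mem fun t _ => And.intro (Fin.zero_le t.1) (Fin.le_last t.2.2)
  rw [hall] at this
  rw [this, Finset.range_eq_Ico]
  rfl

/-! ### Areas of triangles -/

/-- Twice the signed area of a triangle. -/
def orient {n : ℕ} (q : Fin (n + 3) → EuclideanSpace ℝ (Fin 2)) (i j k : Fin (n + 3)) : ℝ :=
  (q j 0 - q i 0) * (q k 1 - q i 1) - (q j 1 - q i 1) * (q k 0 - q i 0)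

/-- The set of vertices of the standard triangle. -/
def standardTriangle : Set (EuclideanSpace ℝ (Fin 2)) :=
  insert 0 (Set.range (EuclideanSpace.basisFun (Fin 2) ℝ))

/-- The area of the standard triangle. -/
def standardArea : ℝ :=
  (MeasureTheory.volume (convexHull ℝ standardTriangle)).toReal

lemma finite_standardTriangle : standardTriangle.Finite :=
  (Set.finite_range _).insert _

/-- Only the positivity of this constant matters; its value is never needed. -/
lemma standardArea_pos : 0 < standardArea := by
  refine ENNReal.toReal_pos ?_ ?_
  · refine (MeasureTheory.Measure.measure_pos_of_nonempty_interior _ ?_).ne'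
    rw [interior_convexHull_nonempty_iff_affineSpan_eq_top]
    have h := affineSpan_insert_zero (k := ℝ) (s := Set.range (EuclideanSpace.basisFun (Fin 2) ℝ))
    have h2 : Submodule.span ℝ (Set.range (EuclideanSpace.basisFun (Fin 2) ℝ)) = ⊤ := by
      have := (EuclideanSpace.basisFun (Fin 2) ℝ).toBasis.span_eq
      rwa [OrthonormalBasis.coe_toBasis] at this
    rw [h2] at h
    exact SetLike.coe_injective (by simpa [standardTriangle] using h)
  · exact (finite_standardTriangle.isCompact_convexHull ℝ).measure_lt_top.ne

/-- The triangle is the image of the standard one under an affine map, and the determinant of its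
linear part is the expression in the absolute value. -/
lemma volume_convexHull_triangle (a b c : EuclideanSpace ℝ (Fin 2)) :
    (MeasureTheory.volume (convexHull ℝ {a, b, c})).toReal =
      standardArea * |(b 0 - a 0) * (c 1 - a 1) - (b 1 - a 1) * (c 0 - a 0)| := by
  let B := (EuclideanSpace.basisFun (Fin 2) ℝ).toBasis
  let M : Matrix (Fin 2) (Fin 2) ℝ := !![b 0 - a 0, c 0 - a 0; b 1 - a 1, c 1 - a 1]
  let A : EuclideanSpace ℝ (Fin 2) →ₗ[ℝ] EuclideanSpace ℝ (Fin 2) := Matrix.toLin B B M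
  have hA : ∀ j, A (EuclideanSpace.basisFun (Fin 2) ℝ j) = ![b - a, c - a] j := by
    intro j
    have : EuclideanSpace.basisFun (Fin 2) ℝ j = B j := by simp [B]
    rw [this]
    simp only [A, Matrix.toLin_self]
    ext k
    fin_cases j <;> fin_cases k <;> simp [B, M, Fin.sum_univ_two]
  have himg : ({a, b, c} : Set (EuclideanSpace ℝ (Fin 2))) =
      (fun x => x + a) '' (A '' standardTriangle) := by
    rw [standardTriangle, Set.image_insert_eq, ← Set.range_comp, Set.image_insert_eq,
      ← Set.range_comp]
    have : ((fun x => x + a) ∘ A ∘ (EuclideanSpace.basisFun (Fin 2) ℝ)) = ![b, c] := by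
      funext j
      simp only [Function.comp_apply, hA]
      fin_cases j <;> simp
    rw [this]
    simp only [Matrix.range_cons, Matrix.range_empty, Set.union_empty, Set.singleton_union,
      zero_add, map_zero]
  have hhull : convexHull ℝ ({a, b, c} : Set (EuclideanSpace ℝ (Fin 2))) =
      (fun x => x + a) '' (A '' convexHull ℝ standardTriangle) := by
    rw [himg, A.image_convexHull]
    exact ((AffineEquiv.vaddConst ℝ a).toAffineMap.image_convexHull _).symm
  rw [hhull, Set.image_add_right, MeasureTheory.measure_preimage_add_right,
    MeasureTheory.Measure.addHaar_image_linearMap, ENNReal.toReal_mul,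
    ENNReal.toReal_ofReal (abs_nonneg _), mul_comm, standardArea]
  congr 2
  simp only [A, LinearMap.det_toLin, M, Matrix.det_fin_two_of]
  ring

/-- The weighted sum of the areas of the triangles of a triangulation, where the weight of a
triangle is the sum of the values of `w` at its vertices. -/
def weightedArea {n : ℕ} (q : Fin (n + 3) → EuclideanSpace ℝ (Fin 2)) (w : Fin (n + 3) → ℝ)
    (T : Finset (Diagonal n)) : ℝ :=
  ∑ t ∈ orderedTriangles T, orient q t.1 t.2.1 t.2.2 * (w t.1 + w t.2.1 + w t.2.2)

/-- Exchanging the sums over vertices and triangles gives each triangle the sum of `w` at its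
corners. Convexity makes increasing triples positively oriented, so areas become `orient` without
absolute values. `weightedArea` is six times the integral of the interpolation of `w`. -/
lemma dotProduct_gkzVector {n : ℕ} {q : Fin (n + 3) → EuclideanSpace ℝ (Fin 2)}
    (hq : IsConvexPolygon q) (w : Fin (n + 3) → ℝ) (T : Finset (Diagonal n)) :
    w ⬝ᵥ gkzVector q T = standardArea * weightedArea q w T := by
  have h1 : w ⬝ᵥ gkzVector q T = ∑ σ ∈ triangles T,
      (MeasureTheory.volume (convexHull ℝ (q '' (σ : Set (Fin (n + 3)))))).toReal *
        ∑ a ∈ σ, w a := by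
    simp only [dotProduct, gkzVector, Finset.mul_sum]
    rw [Finset.sum_comm' (t' := triangles T) (s' := fun σ => σ)]
    · exact Finset.sum_congr rfl fun σ _ => Finset.sum_congr rfl fun a _ => mul_comm _ _
    · intro a σ
      simp [and_comm]
  rw [h1, sum_triangles T fun σ =>
    (MeasureTheory.volume (convexHull ℝ (q '' (σ : Set (Fin (n + 3)))))).toReal * ∑ a ∈ σ, w a,
    weightedArea, Finset.mul_sum]
  refine Finset.sum_congr rfl ?_
  rintro ⟨a, b, c⟩ ht
  obtain ⟨hab, hbc, -⟩ := mem_orderedTriangles.1 ht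
  have hpos : 0 < orient q a b c := hq a b c hab hbc
  have hsum : ∑ k ∈ ({a, b, c} : Finset (Fin (n + 3))), w k = w a + w b + w c := by
    rw [Finset.sum_insert (by simp [hab.ne, (hab.trans hbc).ne]),
      Finset.sum_insert (by simp [hbc.ne]), Finset.sum_singleton, add_assoc]
  have himg : q '' (({a, b, c} : Finset (Fin (n + 3))) : Set (Fin (n + 3))) = {q a, q b, q c} := by
    simp [Set.image_insert_eq]
  simp only
  rw [hsum, himg, volume_convexHull_triangle]
  rw [orient] at hpos
  rw [abs_of_pos hpos, orient]
  ring

/-! ### Weighted areas of affine and of bent functions -/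

/-- The divided difference of the square of the positive part. -/
def posSqSlope (s t : ℝ) : ℝ :=
  if 0 ≤ s then if 0 ≤ t then s + t else s ^ 2 / (s - t)
  else if 0 ≤ t then t ^ 2 / (t - s) else 0

lemma posSqSlope_comm (s t : ℝ) : posSqSlope s t = posSqSlope t s := by
  unfold posSqSlope
  split_ifs <;> ring

lemma posSqSlope_of_nonneg {s t : ℝ} (hs : 0 ≤ s) (ht : 0 ≤ t) : posSqSlope s t = s + t := by
  simp [posSqSlope, hs, ht]

lemma posSqSlope_of_nonneg_of_nonpos {s t : ℝ} (hs : 0 ≤ s) (ht : t ≤ 0) :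
    posSqSlope s t = s ^ 2 / (s - t) := by
  rcases ht.lt_or_eq with h | rfl
  · simp [posSqSlope, hs, h.not_ge]
  · rw [posSqSlope_of_nonneg hs le_rfl]
    rcases hs.lt_or_eq with h | rfl
    · field_simp; ring
    · simp

lemma posSqSlope_of_nonpos {s t : ℝ} (hs : s ≤ 0) (ht : t ≤ 0) : posSqSlope s t = 0 := by
  rcases hs.lt_or_eq with h | rfl
  · rcases ht.lt_or_eq with h' | rfl
    · simp [posSqSlope, h.not_ge, h'.not_ge]
    · simp [posSqSlope, h.not_ge]
  · rw [posSqSlope_of_nonneg_of_nonpos le_rfl ht]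
    simp

lemma posSqSlope_eq_add_neg (s t : ℝ) : posSqSlope s t = s + t + posSqSlope (-s) (-t) := by
  rcases le_total 0 s with hs | hs <;> rcases le_total 0 t with ht | ht
  · rw [posSqSlope_of_nonneg hs ht, posSqSlope_of_nonpos (by linarith) (by linarith), add_zero]
  · rw [posSqSlope_of_nonneg_of_nonpos hs ht, posSqSlope_comm (-s),
      posSqSlope_of_nonneg_of_nonpos (by linarith) (by linarith)]
    rcases eq_or_ne (s - t) 0 with h | h
    · have h1 : s = 0 := by linarith
      have h2 : t = 0 := by linarith
      simp [h1, h2]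
    · rw [show -t - -s = s - t by ring]
      field_simp
      ring
  · rw [posSqSlope_comm, posSqSlope_of_nonneg_of_nonpos ht hs,
      posSqSlope_of_nonneg_of_nonpos (by linarith) (by linarith)]
    rcases eq_or_ne (t - s) 0 with h | h
    · have h1 : s = 0 := by linarith
      have h2 : t = 0 := by linarith
      simp [h1, h2]
    · rw [show -s - -t = t - s by ring]
      field_simp
      ring
  · rw [posSqSlope_of_nonpos hs ht, posSqSlope_of_nonneg (by linarith) (by linarith)]
    ring

/-! ### The convexity inequality on a single triangle -/

/-- The comparison of the interpolation of a bent function on a triangle with its integral.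
Here `s`, `t`, `v` are the values at the vertices of the linear form that defines the bend, and
`p`, `q`, `r` are barycentric coordinates of a point of the bend, up to a positive factor. -/
def BentTriangle (p q r s t v : ℝ) : Prop :=
  p * posSqSlope t v + q * posSqSlope v s + r * posSqSlope s t ≤
      (p + q + r) * (max 0 s + max 0 t + max 0 v) ∧
    ((0 < s ∨ 0 < t ∨ 0 < v) → (s < 0 ∨ t < 0 ∨ v < 0) →
      p * posSqSlope t v + q * posSqSlope v s + r * posSqSlope s t <
        (p + q + r) * (max 0 s + max 0 t + max 0 v))

lemma BentTriangle.rotate {p q r s t v : ℝ} (h : BentTriangle p q r s t v) :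
    BentTriangle q r p t v s := by
  obtain ⟨h1, h2⟩ := h
  refine ⟨by linarith, fun h3 h4 => ?_⟩
  have := h2 (by tauto) (by tauto)
  linarith

/-- Passing from max(0, x) to max(0, −x) subtracts the linear function x, for which both sides agree
because of `h0`. Together with rotation this reduces all sign patterns to at most one positive
value. -/
lemma BentTriangle.of_neg {p q r s t v : ℝ} (h0 : s * p + t * q + v * r = 0)
    (h : BentTriangle p q r (-s) (-t) (-v)) : BentTriangle p q r s t v := by
  have hm : ∀ x : ℝ, max 0 x = x + max 0 (-x) := by
    intro x
    rcases le_total 0 x with hx | hx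
    · rw [max_eq_right hx, max_eq_left (by linarith)]; ring
    · rw [max_eq_left hx, max_eq_right (by linarith)]; ring
  obtain ⟨h1, h2⟩ := h
  have key : p * posSqSlope t v + q * posSqSlope v s + r * posSqSlope s t -
      (p + q + r) * (max 0 s + max 0 t + max 0 v) =
      p * posSqSlope (-t) (-v) + q * posSqSlope (-v) (-s) + r * posSqSlope (-s) (-t) -
      (p + q + r) * (max 0 (-s) + max 0 (-t) + max 0 (-v)) := by
    rw [posSqSlope_eq_add_neg s, posSqSlope_eq_add_neg t, posSqSlope_eq_add_neg v, hm s, hm t, hm v]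
    linear_combination -h0
  refine ⟨by linarith, fun h3 h4 => ?_⟩
  have := h2 (by simpa using h4) (by simpa using h3)
  linarith

lemma bentTriangle_of_one_pos {p q r s t v : ℝ} (h0 : s * p + t * q + v * r = 0)
    (hpos : 0 < p + q + r) (hs : 0 ≤ s) (ht : t ≤ 0) (hv : v ≤ 0) :
    BentTriangle p q r s t v := by
  unfold BentTriangle
  rw [posSqSlope_of_nonpos ht hv, posSqSlope_comm v, posSqSlope_of_nonneg_of_nonpos hs hv,
    posSqSlope_of_nonneg_of_nonpos hs ht, max_eq_right hs, max_eq_left ht, max_eq_left hv]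
  rcases hs.lt_or_eq with hs | rfl
  swap
  · refine ⟨by simp, fun h => ?_⟩
    exfalso
    rcases h with h | h | h <;> linarith
  have hst : 0 < s - t := by linarith
  have hsv : 0 < s - v := by linarith
  have hne := hst.ne'
  have hne' := hsv.ne'
  -- A closed form of the gap between the two sides; `h0` eliminates the separate dependence on `p`,
  -- `q`, `r`, whose individual signs are unknown.
  have key : (p + q + r) * (s + 0 + 0) -
      (p * 0 + q * (s ^ 2 / (s - v)) + r * (s ^ 2 / (s - t))) =
      (p + q + r) * s * ((-t) * (s - v) + s * (-v)) / ((s - t) * (s - v)) := by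
    field_simp
    linear_combination s ^ 2 * h0
  constructor
  · have : 0 ≤ (p + q + r) * s * ((-t) * (s - v) + s * (-v)) / ((s - t) * (s - v)) := by
      have h1 : 0 ≤ (-t) * (s - v) := mul_nonneg (by linarith) hsv.le
      have h2 : 0 ≤ s * (-v) := mul_nonneg hs.le (by linarith)
      positivity
    linarith
  · intro _ h
    have : 0 < (p + q + r) * s * ((-t) * (s - v) + s * (-v)) / ((s - t) * (s - v)) := by
      have h1 : 0 ≤ (-t) * (s - v) := mul_nonneg (by linarith) hsv.le
      have h2 : 0 ≤ s * (-v) := mul_nonneg hs.le (by linarith)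
      have h3 : 0 < (-t) * (s - v) + s * (-v) := by
        rcases h with h | h | h
        · linarith
        · have : 0 < (-t) * (s - v) := mul_pos (by linarith) hsv
          linarith
        · have : 0 < s * (-v) := mul_pos hs (by linarith)
          linarith
      positivity
    linarith

lemma bentTriangle_of_nonpos {p q r s t v : ℝ} (hs : s ≤ 0) (ht : t ≤ 0) (hv : v ≤ 0) :
    BentTriangle p q r s t v := by
  refine ⟨?_, fun h => ?_⟩
  · rw [posSqSlope_of_nonpos ht hv, posSqSlope_of_nonpos hv hs, posSqSlope_of_nonpos hs ht,
      max_eq_left hs, max_eq_left ht, max_eq_left hv]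
    simp
  · exfalso
    rcases h with h | h | h <;> linarith

lemma bentTriangle {p q r s t v : ℝ} (h0 : s * p + t * q + v * r = 0)
    (hpos : 0 < p + q + r) : BentTriangle p q r s t v := by
  rcases le_total 0 s with hs | hs <;> rcases le_total 0 t with ht | ht <;>
    rcases le_total 0 v with hv | hv
  · exact .of_neg h0 (bentTriangle_of_nonpos (by linarith) (by linarith) (by linarith))
  · exact .of_neg h0 (.rotate (bentTriangle_of_one_pos (by linarith) (by linarith) (by linarith)
      (by linarith) (by linarith)))
  · exact .of_neg h0 (.rotate (.rotate (bentTriangle_of_one_pos (by linarith) (by linarith)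
      (by linarith) (by linarith) (by linarith))))
  · exact bentTriangle_of_one_pos h0 hpos hs ht hv
  · exact .of_neg h0 (bentTriangle_of_one_pos (by linarith) (by linarith) (by linarith)
      (by linarith) (by linarith))
  · exact .rotate (.rotate (bentTriangle_of_one_pos (by linarith) (by linarith) ht hv hs))
  · exact .rotate (bentTriangle_of_one_pos (by linarith) (by linarith) hv hs ht)
  · exact bentTriangle_of_nonpos hs ht hv

/-- The equality case of the comparison: no bend in the interior of the triangle. -/
lemma bentTriangle_eq {p q r s t v : ℝ} (h0 : s * p + t * q + v * r = 0)
    (h : (0 ≤ s ∧ 0 ≤ t ∧ 0 ≤ v) ∨ (s ≤ 0 ∧ t ≤ 0 ∧ v ≤ 0)) :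
    p * posSqSlope t v + q * posSqSlope v s + r * posSqSlope s t =
      (p + q + r) * (max 0 s + max 0 t + max 0 v) := by
  rcases h with ⟨hs, ht, hv⟩ | ⟨hs, ht, hv⟩
  · rw [posSqSlope_of_nonneg ht hv, posSqSlope_of_nonneg hv hs, posSqSlope_of_nonneg hs ht,
      max_eq_right hs, max_eq_right ht, max_eq_right hv]
    linear_combination -h0
  · rw [posSqSlope_of_nonpos ht hv, posSqSlope_of_nonpos hv hs, posSqSlope_of_nonpos hs ht,
      max_eq_left hs, max_eq_left ht, max_eq_left hv]
    simp

/-! ### Bent functions and their weighted areas -/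

section Bend

variable {n : ℕ} {q : Fin (n + 3) → EuclideanSpace ℝ (Fin 2)}

/-- The linear form that defines the line through the end points of `d`. -/
def diagForm (q : Fin (n + 3) → EuclideanSpace ℝ (Fin 2)) (d : Diagonal n) (k : Fin (n + 3)) : ℝ :=
  orient q d.1.1 d.1.2 k

/-- The height function that is bent exactly along `d`. -/
def bend (q : Fin (n + 3) → EuclideanSpace ℝ (Fin 2)) (d : Diagonal n) (k : Fin (n + 3)) : ℝ :=
  max 0 (diagForm q d k)

/-- The affine functions on the vertices. -/
def affineHeight (q : Fin (n + 3) → EuclideanSpace ℝ (Fin 2)) (α : ℝ × ℝ × ℝ)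
    (k : Fin (n + 3)) : ℝ :=
  α.1 + α.2.1 * q k 0 + α.2.2 * q k 1

lemma diagForm_left (d : Diagonal n) : diagForm q d d.1.1 = 0 := by
  simp [diagForm, orient]

lemma diagForm_right (d : Diagonal n) : diagForm q d d.1.2 = 0 := by
  simp only [diagForm, orient]; ring

lemma diagForm_neg (hq : IsConvexPolygon q) {d : Diagonal n} {k : Fin (n + 3)}
    (h1 : d.1.1 < k) (h2 : k < d.1.2) : diagForm q d k < 0 := by
  have := hq _ _ _ h1 h2
  simp only [diagForm, orient]
  linarith

lemma diagForm_pos (hq : IsConvexPolygon q) {d : Diagonal n} {k : Fin (n + 3)}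
    (h : k < d.1.1 ∨ d.1.2 < k) : 0 < diagForm q d k := by
  rcases h with h | h
  · have := hq _ _ _ h d.2.1
    simp only [diagForm, orient]
    linarith
  · exact hq _ _ _ d.2.1 h

lemma diagForm_nonpos_iff (hq : IsConvexPolygon q) {d : Diagonal n} {k : Fin (n + 3)} :
    diagForm q d k ≤ 0 ↔ d.1.1 ≤ k ∧ k ≤ d.1.2 := by
  constructor
  · intro h
    by_contra hc
    have := diagForm_pos hq (d := d) (k := k) (by omega)
    linarith
  · rintro ⟨h1, h2⟩
    rcases h1.eq_or_lt with rfl | h1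
    · rw [diagForm_left]
    rcases h2.eq_or_lt with rfl | h2
    · rw [diagForm_right]
    exact (diagForm_neg hq h1 h2).le

lemma diagForm_nonneg_iff (hq : IsConvexPolygon q) {d : Diagonal n} {k : Fin (n + 3)} :
    0 ≤ diagForm q d k ↔ k ≤ d.1.1 ∨ d.1.2 ≤ k := by
  constructor
  · intro h
    by_contra hc
    have := diagForm_neg hq (d := d) (k := k) (by omega) (by omega)
    linarith
  · rintro (h | h) <;> rcases h.eq_or_lt with rfl | h
    · rw [diagForm_left]
    · exact (diagForm_pos hq (Or.inl h)).le
    · rw [diagForm_right]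
    · exact (diagForm_pos hq (Or.inr h)).le

/-- The cochain whose coboundary integrates the bent function. -/
def bendCochain (q : Fin (n + 3) → EuclideanSpace ℝ (Fin 2)) (d : Diagonal n)
    (a b : Fin (n + 3)) : ℝ :=
  orient q d.1.1 a b * posSqSlope (diagForm q d a) (diagForm q d b)

/-- The hypotheses of `bentTriangle` for the barycentric coordinates of the end point `d.1.1`, at
which the form vanishes. On a triangle with values 0, s, t at its corners, six times the integral of
the positive part is `orient` times `posSqSlope s t`. So the cochain integrates over the signed
triangle from `d.1.1` to `a`, `b`, and its coboundary integrates over `abc`. -/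
lemma bendCochain_relations (d : Diagonal n) (a b c : Fin (n + 3)) :
    diagForm q d a * orient q d.1.1 b c + diagForm q d b * orient q d.1.1 c a +
      diagForm q d c * orient q d.1.1 a b = 0 ∧
    orient q d.1.1 b c + orient q d.1.1 c a + orient q d.1.1 a b = orient q a b c ∧
    orient q d.1.1 b c * posSqSlope (diagForm q d b) (diagForm q d c) +
      orient q d.1.1 c a * posSqSlope (diagForm q d c) (diagForm q d a) +
      orient q d.1.1 a b * posSqSlope (diagForm q d a) (diagForm q d b) =
    bendCochain q d a b + bendCochain q d b c - bendCochain q d a c := by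
  refine ⟨?_, ?_, ?_⟩
  · simp only [diagForm, orient]; ring
  · simp only [orient]; ring
  · simp only [bendCochain]
    rw [posSqSlope_comm (diagForm q d c) (diagForm q d a)]
    simp only [orient]
    ring

lemma IsTriangulation.exists_orderedTriangle {T : Finset (Diagonal n)} (hT : IsTriangulation T)
    {e : Diagonal n} (he : e ∈ T) : ∃ k, (e.1.1, k, e.1.2) ∈ orderedTriangles T := by
  have h1 := e.2.1
  have h2 := e.2.2
  simp only [IsSide, not_or] at h2
  obtain ⟨k, h⟩ := hT.exists_apex (by omega) (isEdge_of_mem he)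
  exact ⟨k, mem_orderedTriangles.2 ⟨h.1, h.2.1, h.2.2.1, h.2.2.2, isEdge_of_mem he⟩⟩

/-- The minimum of the weighted area of a bent function. -/
def minBendArea (q : Fin (n + 3) → EuclideanSpace ℝ (Fin 2)) (d : Diagonal n) : ℝ :=
  ∑ k ∈ Finset.range (n + 2), sideValue (bendCochain q d) k -
    bendCochain q d 0 (Fin.last (n + 2))

/-- No triangle of `T` straddles a diagonal of `T`, so the bent function is linear on each triangle
and interpolation loses nothing. -/
lemma weightedArea_bend_of_mem (hq : IsConvexPolygon q) {T : Finset (Diagonal n)}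
    (hT : IsTriangulation T) {d : Diagonal n} (hd : d ∈ T) :
    weightedArea q (bend q d) T = minBendArea q d := by
  rw [minBendArea, ← hT.sum_coboundary, weightedArea]
  refine Finset.sum_congr rfl ?_
  rintro ⟨a, b, c⟩ ht
  obtain ⟨hab, hbc, eab, ebc, eac⟩ := mem_orderedTriangles.1 ht
  obtain ⟨h0, h1, h2⟩ := bendCochain_relations (q := q) d a b c
  simp only
  rw [← h2, ← h1]
  refine (bentTriangle_eq h0 ?_).symm
  simp only [diagForm_nonneg_iff hq, diagForm_nonpos_iff hq]
  have ed := isEdge_of_mem hd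
  have := IsEdge.not_cross hT.1 ed eab
  have := IsEdge.not_cross hT.1 ed ebc
  have := IsEdge.not_cross hT.1 ed eac
  have := IsEdge.not_cross hT.1 eab ed
  have := IsEdge.not_cross hT.1 ebc ed
  have := IsEdge.not_cross hT.1 eac ed
  have := d.2.1
  omega

lemma bend_triangle_bounds (hq : IsConvexPolygon q) {T : Finset (Diagonal n)} (d : Diagonal n)
    {a b c : Fin (n + 3)} (ht : (a, b, c) ∈ orderedTriangles T) :
    bendCochain q d a b + bendCochain q d b c - bendCochain q d a c ≤
      orient q a b c * (bend q d a + bend q d b + bend q d c) ∧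
    ((0 < diagForm q d a ∨ 0 < diagForm q d b ∨ 0 < diagForm q d c) →
      (diagForm q d a < 0 ∨ diagForm q d b < 0 ∨ diagForm q d c < 0) →
      bendCochain q d a b + bendCochain q d b c - bendCochain q d a c <
      orient q a b c * (bend q d a + bend q d b + bend q d c)) := by
  obtain ⟨hab, hbc, -⟩ := mem_orderedTriangles.1 ht
  obtain ⟨h0, h1, h2⟩ := bendCochain_relations (q := q) d a b c
  have hpos : 0 < orient q a b c := hq a b c hab hbc
  rw [← h2, ← h1]
  exact bentTriangle h0 (h1 ▸ hpos)

lemma minBendArea_le (hq : IsConvexPolygon q) {T : Finset (Diagonal n)}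
    (hT : IsTriangulation T) (d : Diagonal n) :
    minBendArea q d ≤ weightedArea q (bend q d) T := by
  rw [minBendArea, ← hT.sum_coboundary, weightedArea]
  exact Finset.sum_le_sum fun t ht => (bend_triangle_bounds hq d ht).1

/-- By maximality some edge of `T` crosses `d`. Its ends lie strictly on different sides of the line
of `d`, so a triangle at that edge contributes a strict inequality. -/
lemma minBendArea_lt (hq : IsConvexPolygon q) {T : Finset (Diagonal n)}
    (hT : IsTriangulation T) {d : Diagonal n} (hd : d ∉ T) :
    minBendArea q d < weightedArea q (bend q d) T := by
  rw [minBendArea, ← hT.sum_coboundary, weightedArea]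
  obtain ⟨e, he, hc⟩ : ∃ e ∈ T, Crosses d e := by
    by_contra! h
    exact hd (hT.2 d h)
  obtain ⟨k, hk⟩ := hT.exists_orderedTriangle he
  refine Finset.sum_lt_sum (fun t ht => (bend_triangle_bounds hq d ht).1)
    ⟨_, hk, (bend_triangle_bounds hq d hk).2 ?_ ?_⟩
  · rcases hc with hc | hc
    · exact Or.inr (Or.inr (diagForm_pos hq (Or.inr hc.2.2)))
    · exact Or.inl (diagForm_pos hq (Or.inl hc.1))
  · rcases hc with hc | hc
    · exact Or.inl (diagForm_neg hq hc.1 hc.2.1)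
    · exact Or.inr (Or.inr (diagForm_neg hq hc.2.1 hc.2.2))

/-- The weighted area of an affine function does not depend on the triangulation. -/
lemma weightedArea_affineHeight {T T' : Finset (Diagonal n)} (hT : IsTriangulation T)
    (hT' : IsTriangulation T') (α : ℝ × ℝ × ℝ) :
    weightedArea q (affineHeight q α) T = weightedArea q (affineHeight q α) T' := by
  obtain ⟨h, hh⟩ : ∃ h : Fin (n + 3) → Fin (n + 3) → ℝ, ∀ a b c,
      orient q a b c * (affineHeight q α a + affineHeight q α b + affineHeight q α c) =
        h a b + h b c - h a c := by
    -- Six times the signed integral of the affine function over the triangle with corners at the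
    -- origin, `q a` and `q b`; its value at the origin is `α.1`.
    refine ⟨fun a b => (q a 0 * q b 1 - q a 1 * q b 0) *
      (α.1 + affineHeight q α a + affineHeight q α b), fun a b c => ?_⟩
    simp only [affineHeight, orient]
    ring
  simp only [weightedArea, hh]
  rw [hT.sum_coboundary, hT'.sum_coboundary]

end Bend

section Decomposition

variable {n : ℕ} {q : Fin (n + 3) → EuclideanSpace ℝ (Fin 2)}

/-! ### Height functions as combinations of bent functions -/

/-- The height functions that are linear on the triangles of `T`, given by their bends. -/
def bentHeights (q : Fin (n + 3) → EuclideanSpace ℝ (Fin 2)) (T : Finset (Diagonal n)) :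
    Submodule ℝ (Fin (n + 3) → ℝ) where
  carrier := {w | ∃ (α : ℝ × ℝ × ℝ) (c : Diagonal n → ℝ),
    w = affineHeight q α + ∑ d ∈ T, c d • bend q d}
  add_mem' := by
    rintro _ _ ⟨α, c, rfl⟩ ⟨α', c', rfl⟩
    refine ⟨α + α', c + c', ?_⟩
    have : affineHeight q (α + α') = affineHeight q α + affineHeight q α' := by
      funext k; simp only [affineHeight, Pi.add_apply, Prod.fst_add, Prod.snd_add]; ring
    simp only [this, Pi.add_apply, add_smul, Finset.sum_add_distrib]
    abel
  zero_mem' := by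
    refine ⟨0, 0, ?_⟩
    funext k; simp [affineHeight]
  smul_mem' := by
    rintro r _ ⟨α, c, rfl⟩
    refine ⟨r • α, r • c, ?_⟩
    have : affineHeight q (r • α) = r • affineHeight q α := by
      funext k; simp only [affineHeight, Pi.smul_apply, Prod.smul_fst, Prod.smul_snd, smul_eq_mul]
      ring
    simp only [this, Pi.smul_apply, smul_assoc, smul_add, Finset.smul_sum]

lemma affineHeight_mem_bentHeights (T : Finset (Diagonal n)) (α : ℝ × ℝ × ℝ) :
    affineHeight q α ∈ bentHeights q T :=
  ⟨α, 0, by simp⟩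

lemma bend_mem_bentHeights {T : Finset (Diagonal n)} {d : Diagonal n} (hd : d ∈ T) :
    bend q d ∈ bentHeights q T := by
  refine ⟨0, Pi.single d 1, ?_⟩
  rw [Finset.sum_eq_single_of_mem d hd]
  · funext k; simp [affineHeight]
  · intro e _ hne
    rw [Pi.single_eq_of_ne hne, zero_smul]

lemma exists_affineHeight_eq_orient (q : Fin (n + 3) → EuclideanSpace ℝ (Fin 2))
    (i j : Fin (n + 3)) : ∃ α, affineHeight q α = fun k => orient q i j k := by
  refine ⟨(-(q j 0 - q i 0) * q i 1 + (q j 1 - q i 1) * q i 0, -(q j 1 - q i 1),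
    q j 0 - q i 0), ?_⟩
  funext k
  simp only [affineHeight, orient]
  ring

lemma orient_mem_bentHeights (T : Finset (Diagonal n)) (i j : Fin (n + 3)) :
    (fun k => orient q i j k) ∈ bentHeights q T := by
  obtain ⟨α, hα⟩ := exists_affineHeight_eq_orient q i j
  rw [← hα]
  exact affineHeight_mem_bentHeights T α

/-- For a diagonal, max(0, ℓ) − ℓ lives exactly on the vertices strictly between its ends; for the
long side ℓ itself does. These functions make the system triangular in `bentHeights_eq_top`. -/
lemma exists_mem_bentHeights_support (hq : IsConvexPolygon q) {T : Finset (Diagonal n)}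
    {i j : Fin (n + 3)} (hij : (i : ℕ) + 1 < j) (he : IsEdge T i j) :
    ∃ f ∈ bentHeights q T, ∀ k, f k ≠ 0 ↔ i < k ∧ k < j := by
  rcases he with (h | ⟨hi, hj⟩) | ⟨d, hd, hd'⟩
  · omega
  · refine ⟨_, orient_mem_bentHeights T i j, fun k => ?_⟩
    have hk := k.2
    constructor
    · intro h
      by_contra hc
      have : k = i ∨ k = j := by omega
      rcases this with rfl | rfl
      · exact h (by simp [orient])
      · exact h (by simp only [orient]; ring)
    · rintro ⟨h1, h2⟩
      have := hq _ _ _ h1 h2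
      simp only [orient]
      intro h
      linarith
  · have hi : d.1.1 = i := by rw [hd']
    have hj : d.1.2 = j := by rw [hd']
    refine ⟨_, (bentHeights q T).sub_mem (bend_mem_bentHeights hd)
      (orient_mem_bentHeights T i j), fun k => ?_⟩
    have h1 := diagForm_nonneg_iff hq (d := d) (k := k)
    have h2 : orient q i j k = diagForm q d k := by rw [diagForm, hi, hj]
    simp only [Pi.sub_apply, bend, h2]
    rw [hi, hj] at h1
    constructor
    · intro h
      by_contra hc
      rw [max_eq_right (h1.2 (by omega)), sub_self] at h
      exact h rfl
    · intro h h0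
      have hneg : diagForm q d k < 0 := by
        by_contra hc
        have := h1.1 (not_lt.1 hc)
        omega
      rw [max_eq_left hneg.le] at h0
      linarith

/-- A functional vanishing on the subspace has coefficient zero everywhere. By induction on the
length of an edge, the vertices between its ends other than the apex are already killed, and the
function supported there kills the apex. Affine functions dispose of the two ends of the long side.
-/
lemma bentHeights_eq_top (hq : IsConvexPolygon q) {T : Finset (Diagonal n)}
    (hT : IsTriangulation T) : bentHeights q T = ⊤ := by
  by_contra hne
  obtain ⟨φ, hφ, hle⟩ := Submodule.exists_le_ker_of_lt_top _ (lt_top_iff_ne_top.2 hne)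
  let l : Fin (n + 3) → ℝ := fun k => φ (Pi.single k 1)
  have hsum : ∀ x : Fin (n + 3) → ℝ, φ x = ∑ k, x k * l k := by
    intro x
    conv_lhs => rw [← Finset.univ_sum_single x]
    rw [map_sum]
    refine Finset.sum_congr rfl fun k _ => ?_
    have : (Pi.single k (x k) : Fin (n + 3) → ℝ) = x k • Pi.single k 1 := by
      rw [← Pi.single_smul]; simp
    rw [this, map_smul, smul_eq_mul]
  have hker : ∀ f ∈ bentHeights q T, ∑ k, f k * l k = 0 := by
    intro f hf
    rw [← hsum]
    exact hle hf
  have key : ∀ m : ℕ, ∀ i j : Fin (n + 3), (j : ℕ) - i ≤ m → IsEdge T i j →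
      ∀ k, i < k → k < j → l k = 0 := by
    intro m
    induction m with
    | zero => intro i j hm he k h1 h2; omega
    | succ m ih =>
      intro i j hm he k hik hkj
      have hij : (i : ℕ) + 1 < j := by omega
      obtain ⟨k₀, h1, h2, e1, e2⟩ := hT.exists_apex hij he
      have hother : ∀ k, i < k → k < j → k ≠ k₀ → l k = 0 := by
        intro k hik hkj hk
        rcases lt_or_gt_of_ne hk with h | h
        · exact ih i k₀ (by omega) e1 k hik h
        · exact ih k₀ j (by omega) e2 k h hkj
      obtain ⟨f, hf, hs⟩ := exists_mem_bentHeights_support hq hij he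
      have h0 := hker f hf
      rw [Finset.sum_eq_single k₀] at h0
      · by_cases hk : k = k₀
        · subst hk
          exact (mul_eq_zero.1 h0).resolve_left ((hs k).2 ⟨h1, h2⟩)
        · exact hother k hik hkj hk
      · intro b _ hb
        by_cases hfb : f b = 0
        · rw [hfb, zero_mul]
        · rw [hother b ((hs b).1 hfb).1 ((hs b).1 hfb).2 hb, mul_zero]
      · simp
  have hin : ∀ k, k ≠ 0 → k ≠ Fin.last (n + 2) → l k = 0 := fun k h1 h2 =>
    key _ 0 (Fin.last (n + 2)) le_rfl (isEdge_zero_last T) k (Fin.pos_iff_ne_zero.2 h1)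
      (Fin.lt_last_iff_ne_last.2 h2)
  have hlast : l (Fin.last (n + 2)) = 0 := by
    have h0 := hker _ (orient_mem_bentHeights T 0 1)
    rw [Finset.sum_eq_single (Fin.last (n + 2))] at h0
    · refine (mul_eq_zero.1 h0).resolve_left ?_
      exact (hq 0 1 (Fin.last (n + 2)) Fin.zero_lt_one
        (by simp [Fin.lt_def])).ne'
    · intro b _ hb
      by_cases hb0 : b = 0
      · subst hb0
        simp [orient]
      · rw [hin b hb0 hb, mul_zero]
    · simp
  have hzero : l 0 = 0 := by
    have h0 := hker _ (affineHeight_mem_bentHeights (q := q) T (1, 0, 0))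
    rw [Finset.sum_eq_single 0] at h0
    · simpa [affineHeight] using h0
    · intro b _ hb
      by_cases hbl : b = Fin.last (n + 2)
      · rw [hbl, hlast, mul_zero]
      · rw [hin b hb hbl, mul_zero]
    · simp
  refine hφ (LinearMap.ext fun x => ?_)
  rw [hsum, LinearMap.zero_apply]
  refine Finset.sum_eq_zero fun k _ => ?_
  by_cases h1 : k = 0
  · rw [h1, hzero, mul_zero]
  by_cases h2 : k = Fin.last (n + 2)
  · rw [h2, hlast, mul_zero]
  · rw [hin k h1 h2, mul_zero]

lemma exists_eq_affineHeight_add_bends (hq : IsConvexPolygon q) {T : Finset (Diagonal n)}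
    (hT : IsTriangulation T) (w : Fin (n + 3) → ℝ) :
    ∃ (α : ℝ × ℝ × ℝ) (c : Diagonal n → ℝ), w = affineHeight q α + ∑ d ∈ T, c d • bend q d := by
  have : w ∈ bentHeights q T := by rw [bentHeights_eq_top hq hT]; trivial
  exact this

/-! ### A combination of two bent functions is not affine -/

/-- Nested or disjoint diagonals provide the three vertices among their ends, and equal ones with a
vertex in between. Crossing diagonals need a fifth vertex, whence `2 ≤ n`: the claim fails for the
two diagonals of a quadrilateral. -/
lemma exists_common_side (hn : 2 ≤ n) (d e : Diagonal n) :
    ∃ a b c : Fin (n + 3), a < b ∧ b < c ∧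
      ((∀ k, k = a ∨ k = b ∨ k = c → d.1.1 ≤ k ∧ k ≤ d.1.2) ∨
        (∀ k, k = a ∨ k = b ∨ k = c → k ≤ d.1.1 ∨ d.1.2 ≤ k)) ∧
      ((∀ k, k = a ∨ k = b ∨ k = c → e.1.1 ≤ k ∧ k ≤ e.1.2) ∨
        (∀ k, k = a ∨ k = b ∨ k = c → k ≤ e.1.1 ∨ e.1.2 ≤ k)) := by
  wlog hde : d.1.1 ≤ e.1.1 generalizing d e
  · obtain ⟨a, b, c, h1, h2, h3, h4⟩ := this e d (le_of_not_ge hde)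
    exact ⟨a, b, c, h1, h2, h4, h3⟩
  obtain ⟨⟨⟨i, j⟩, hij, hs⟩, rfl⟩ : ∃ d₀, d = d₀ := ⟨d, rfl⟩
  obtain ⟨⟨⟨k, l⟩, hkl, hs'⟩, rfl⟩ : ∃ e₀, e = e₀ := ⟨e, rfl⟩
  simp only [IsSide, not_or] at hij hs hkl hs' hde ⊢
  have hj := j.2
  have hl := l.2
  rcases hde.eq_or_lt with rfl | hik
  · rcases lt_trichotomy j l with h | rfl | h
    · exact ⟨i, j, l, hij, h, Or.inr (by omega), Or.inl (by omega)⟩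
    · have : ∃ m : Fin (n + 3), (m : ℕ) = i + 1 := ⟨⟨i + 1, by omega⟩, rfl⟩
      obtain ⟨m, hm⟩ := this
      exact ⟨i, m, j, by omega, by omega, Or.inl (by omega), Or.inl (by omega)⟩
    · exact ⟨i, l, j, hkl, h, Or.inl (by omega), Or.inr (by omega)⟩
  by_cases h1 : l ≤ j
  · exact ⟨i, k, l, hik, hkl, Or.inl (by omega), Or.inr (by omega)⟩
  by_cases h2 : j ≤ k
  · exact ⟨i, j, l, hij, by omega, Or.inr (by omega), Or.inr (by omega)⟩
  -- Now `i < k < j < l`. A fifth vertex lies in one of the four gaps and is taken with the two ends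
  -- that bound the gap.
  have hmk : ∀ x : ℕ, x < n + 3 → ∃ m : Fin (n + 3), (m : ℕ) = x := fun x hx => ⟨⟨x, hx⟩, rfl⟩
  by_cases h3 : (i : ℕ) + 1 < k
  · obtain ⟨m, hm⟩ := hmk (i + 1) (by omega)
    exact ⟨i, m, k, by omega, by omega, Or.inl (by omega), Or.inr (by omega)⟩
  by_cases h4 : (k : ℕ) + 1 < j
  · obtain ⟨m, hm⟩ := hmk (k + 1) (by omega)
    exact ⟨k, m, j, by omega, by omega, Or.inl (by omega), Or.inl (by omega)⟩
  by_cases h5 : (j : ℕ) + 1 < l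
  · obtain ⟨m, hm⟩ := hmk (j + 1) (by omega)
    exact ⟨j, m, l, by omega, by omega, Or.inr (by omega), Or.inl (by omega)⟩
  by_cases h6 : 0 < (i : ℕ)
  · obtain ⟨m, hm⟩ := hmk 0 (by omega)
    exact ⟨m, i, l, by omega, by omega, Or.inr (by omega), Or.inr (by omega)⟩
  · obtain ⟨m, hm⟩ := hmk (n + 2) (by omega)
    exact ⟨i, l, m, by omega, by omega, Or.inr (by omega), Or.inr (by omega)⟩

lemma affineHeight_eq_zero (hq : IsConvexPolygon q) {a b c : Fin (n + 3)} (hab : a < b)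
    (hbc : b < c) {α : ℝ × ℝ × ℝ}
    (h : ∀ k, k = a ∨ k = b ∨ k = c → affineHeight q α k = 0) (k : Fin (n + 3)) :
    affineHeight q α k = 0 := by
  have hpos : 0 < orient q a b c := hq a b c hab hbc
  have key : orient q a b c * affineHeight q α k = affineHeight q α a * orient q k b c +
      affineHeight q α b * orient q a k c + affineHeight q α c * orient q a b k := by
    simp only [affineHeight, orient]; ring
  rw [h a (by simp), h b (by simp), h c (by simp)] at key
  simp only [zero_mul, add_zero] at key
  exact (mul_eq_zero.1 key).resolve_left hpos.ne'

/-- Three vertices on one side of `d` lie on a supporting plane of the graph of the bent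
function. -/
lemma exists_affineHeight_le_bend (hq : IsConvexPolygon q) (d : Diagonal n) {a b c : Fin (n + 3)}
    (h : (∀ k, k = a ∨ k = b ∨ k = c → d.1.1 ≤ k ∧ k ≤ d.1.2) ∨
      (∀ k, k = a ∨ k = b ∨ k = c → k ≤ d.1.1 ∨ d.1.2 ≤ k)) :
    ∃ β, (∀ k, affineHeight q β k ≤ bend q d k) ∧
      (∀ k, k = a ∨ k = b ∨ k = c → affineHeight q β k = bend q d k) ∧
      ∃ k, affineHeight q β k < bend q d k := by
  have h1 := d.2.1
  have h2 := d.2.2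
  have h3 := d.1.2.2
  simp only [IsSide, not_or] at h2
  rcases h with h | h
  · refine ⟨0, fun k => ?_, fun k hk => ?_, ?_⟩
    · simp [affineHeight, bend]
    · rw [bend, max_eq_left ((diagForm_nonpos_iff hq).2 (h k hk))]
      simp [affineHeight]
    · obtain ⟨k, hk⟩ : ∃ k, k < d.1.1 ∨ d.1.2 < k := by
        by_cases h0 : (d.1.1 : ℕ) = 0
        · exact ⟨⟨n + 2, by omega⟩, Or.inr (by rw [Fin.lt_def]; simp only; omega)⟩
        · exact ⟨0, Or.inl (by rw [Fin.lt_def, Fin.val_zero]; omega)⟩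
      refine ⟨k, ?_⟩
      have := diagForm_pos hq hk
      rw [bend, max_eq_right this.le]
      simpa [affineHeight] using this
  · obtain ⟨β, hβ⟩ := exists_affineHeight_eq_orient q d.1.1 d.1.2
    have hβ' : ∀ k, affineHeight q β k = diagForm q d k := fun k => congrFun hβ k
    refine ⟨β, fun k => ?_, fun k hk => ?_, ?_⟩
    · rw [hβ']; exact le_max_right _ _
    · rw [hβ', bend, max_eq_right ((diagForm_nonneg_iff hq).2 (h k hk))]
    · refine ⟨⟨d.1.1 + 1, by omega⟩, ?_⟩
      have : diagForm q d ⟨d.1.1 + 1, by omega⟩ < 0 := by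
        refine diagForm_neg hq ?_ ?_ <;> rw [Fin.lt_def] <;> simp only <;> omega
      rw [hβ', bend, max_eq_left this.le]
      exact this

/-- Subtracting supporting affine functions at three common vertices makes both summands nonnegative
and zero at these vertices. An affine sum would vanish identically, but the first summand is
positive somewhere. -/
lemma bend_combination_ne_affineHeight (hn : 2 ≤ n) (hq : IsConvexPolygon q) (d e : Diagonal n)
    {r s : ℝ} (hr : 0 < r) (hs : 0 ≤ s) (α : ℝ × ℝ × ℝ) :
    r • bend q d + s • bend q e ≠ affineHeight q α := by
  intro heq
  obtain ⟨a, b, c, hab, hbc, h1, h2⟩ := exists_common_side hn d e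
  obtain ⟨β, hle, heqβ, k, hk⟩ := exists_affineHeight_le_bend hq d h1
  obtain ⟨γ, hle', heqγ, -⟩ := exists_affineHeight_le_bend hq e h2
  have hlin : ∀ k, affineHeight q (α - r • β - s • γ) k =
      r * (bend q d k - affineHeight q β k) + s * (bend q e k - affineHeight q γ k) := by
    intro k
    have := congrFun heq k
    simp only [Pi.add_apply, Pi.smul_apply, smul_eq_mul] at this
    have h' : affineHeight q (α - r • β - s • γ) k =
        affineHeight q α k - r * affineHeight q β k - s * affineHeight q γ k := by
      simp only [affineHeight, Prod.fst_sub, Prod.snd_sub, Prod.smul_fst, Prod.smul_snd,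
        smul_eq_mul]
      ring
    rw [h', ← this]
    ring
  have hz := affineHeight_eq_zero hq hab hbc (α := α - r • β - s • γ) (fun k hk => by
    rw [hlin, heqβ k hk, heqγ k hk]; ring) k
  rw [hlin] at hz
  have p1 : 0 < r * (bend q d k - affineHeight q β k) := mul_pos hr (by linarith)
  have p2 : 0 ≤ s * (bend q e k - affineHeight q γ k) := mul_nonneg hs (by linarith [hle' k])
  linarith

/-! ### Linear functionals on the secondary polytope -/

lemma gkzVector_mem {T : Finset (Diagonal n)} (hT : IsTriangulation T) :
    gkzVector q T ∈ gkzAssociahedron q :=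
  subset_convexHull ℝ _ ⟨T, hT, rfl⟩

lemma le_dotProduct_of_mem {w x : Fin (n + 3) → ℝ} (hx : x ∈ gkzAssociahedron q) {m : ℝ}
    (h : ∀ T, IsTriangulation T → m ≤ w ⬝ᵥ gkzVector q T) : m ≤ w ⬝ᵥ x := by
  have hc : Convex ℝ {y : Fin (n + 3) → ℝ | m ≤ w ⬝ᵥ y} :=
    convex_halfSpace_ge ⟨fun a b => dotProduct_add w a b, fun c a => dotProduct_smul c w a⟩ m
  refine convexHull_min ?_ hc hx
  rintro _ ⟨T, hT, rfl⟩
  exact h T hT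

lemma dotProduct_affineHeight (hq : IsConvexPolygon q) {x : Fin (n + 3) → ℝ}
    (hx : x ∈ gkzAssociahedron q) {T : Finset (Diagonal n)} (hT : IsTriangulation T)
    (α : ℝ × ℝ × ℝ) : affineHeight q α ⬝ᵥ x = affineHeight q α ⬝ᵥ gkzVector q T := by
  refine le_antisymm ?_ ?_
  · have := le_dotProduct_of_mem (w := -affineHeight q α) hx
      (m := -(affineHeight q α ⬝ᵥ gkzVector q T)) fun T' hT' => by
        rw [neg_dotProduct, dotProduct_gkzVector hq, dotProduct_gkzVector hq,
          weightedArea_affineHeight hT hT']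
    rw [neg_dotProduct] at this
    linarith
  · refine le_dotProduct_of_mem hx fun T' hT' => ?_
    rw [dotProduct_gkzVector hq, dotProduct_gkzVector hq, weightedArea_affineHeight hT hT']

lemma minBendArea_le_dotProduct (hq : IsConvexPolygon q) (d : Diagonal n)
    {x : Fin (n + 3) → ℝ} (hx : x ∈ gkzAssociahedron q) :
    standardArea * minBendArea q d ≤ bend q d ⬝ᵥ x := by
  refine le_dotProduct_of_mem hx fun T hT => ?_
  rw [dotProduct_gkzVector hq]
  exact mul_le_mul_of_nonneg_left (minBendArea_le hq hT d) standardArea_pos.le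

lemma bend_dotProduct_gkzVector (hq : IsConvexPolygon q) {T : Finset (Diagonal n)}
    (hT : IsTriangulation T) {d : Diagonal n} (hd : d ∈ T) :
    bend q d ⬝ᵥ gkzVector q T = standardArea * minBendArea q d := by
  rw [dotProduct_gkzVector hq, weightedArea_bend_of_mem hq hT hd]

/-- The flip at `d` changes the value of only one bend from `T`, so it isolates the coefficient of
that bend in any functional. -/
lemma exists_flipped_point (hq : IsConvexPolygon q) {T : Finset (Diagonal n)}
    (hT : IsTriangulation T) {d : Diagonal n} (hd : d ∈ T) :
    ∃ x ∈ gkzAssociahedron q, standardArea * minBendArea q d < bend q d ⬝ᵥ x ∧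
      ∀ e ∈ T, e ≠ d → bend q e ⬝ᵥ x = standardArea * minBendArea q e := by
  obtain ⟨T', hT', hd', hT''⟩ := hT.exists_flipped hd
  refine ⟨_, gkzVector_mem hT', ?_, fun e he hne => bend_dotProduct_gkzVector hq hT' (hT'' e he hne)⟩
  rw [dotProduct_gkzVector hq]
  exact mul_lt_mul_of_pos_left (minBendArea_lt hq hT' hd') standardArea_pos

lemma dotProduct_sub_gkzVector (hq : IsConvexPolygon q) {T : Finset (Diagonal n)}
    (hT : IsTriangulation T) {α : ℝ × ℝ × ℝ} {c : Diagonal n → ℝ} {x : Fin (n + 3) → ℝ}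
    (hx : x ∈ gkzAssociahedron q) :
    (affineHeight q α + ∑ d ∈ T, c d • bend q d) ⬝ᵥ x -
      (affineHeight q α + ∑ d ∈ T, c d • bend q d) ⬝ᵥ gkzVector q T =
    ∑ d ∈ T, c d * (bend q d ⬝ᵥ x - standardArea * minBendArea q d) := by
  rw [add_dotProduct, add_dotProduct, dotProduct_affineHeight hq hx hT, sum_dotProduct,
    sum_dotProduct, add_sub_add_left_eq_sub, ← Finset.sum_sub_distrib]
  refine Finset.sum_congr rfl fun d hd => ?_
  rw [smul_dotProduct, smul_dotProduct, bend_dotProduct_gkzVector hq hT hd, smul_eq_mul,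
    smul_eq_mul, mul_sub]

lemma exists_flipped_dotProduct (hq : IsConvexPolygon q) {T : Finset (Diagonal n)}
    (hT : IsTriangulation T) (α : ℝ × ℝ × ℝ) (c : Diagonal n → ℝ) {d : Diagonal n} (hd : d ∈ T) :
    ∃ x ∈ gkzAssociahedron q, ∃ r > 0, (affineHeight q α + ∑ d ∈ T, c d • bend q d) ⬝ᵥ x -
      (affineHeight q α + ∑ d ∈ T, c d • bend q d) ⬝ᵥ gkzVector q T = c d * r := by
  obtain ⟨x, hx, hlt, heq⟩ := exists_flipped_point hq hT hd
  refine ⟨x, hx, _, sub_pos.2 hlt, ?_⟩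
  rw [dotProduct_sub_gkzVector hq hT hx, Finset.sum_eq_single_of_mem d hd]
  intro e he hne
  rw [heq e he hne, sub_self, mul_zero]

/-- A functional that is constant on the secondary polytope comes from an affine function. -/
lemma exists_eq_affineHeight_of_const (hq : IsConvexPolygon q) {w : Fin (n + 3) → ℝ}
    (h : ∀ x ∈ gkzAssociahedron q, ∀ y ∈ gkzAssociahedron q, w ⬝ᵥ x = w ⬝ᵥ y) :
    ∃ α, w = affineHeight q α := by
  obtain ⟨T, hT⟩ := exists_isTriangulation n
  obtain ⟨α, c, rfl⟩ := exists_eq_affineHeight_add_bends hq hT w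
  refine ⟨α, ?_⟩
  rw [Finset.sum_eq_zero, add_zero]
  intro d hd
  obtain ⟨x, hx, r, hr, heq⟩ := exists_flipped_dotProduct hq hT α c hd
  rw [h x hx _ (gkzVector_mem hT), sub_self] at heq
  rw [(mul_eq_zero.1 heq.symm).resolve_right hr.ne', zero_smul]

/-- A proper face of the secondary polytope lies in the face of some diagonal. -/
lemma exists_bend_minimal_on_face (hq : IsConvexPolygon q) {w : Fin (n + 3) → ℝ}
    (h : ∃ x ∈ gkzAssociahedron q, ∃ y ∈ gkzAssociahedron q, w ⬝ᵥ x ≠ w ⬝ᵥ y) :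
    ∃ d : Diagonal n, ∀ x ∈ gkzAssociahedron q, (∀ y ∈ gkzAssociahedron q, w ⬝ᵥ y ≤ w ⬝ᵥ x) →
      ∀ y ∈ gkzAssociahedron q, bend q d ⬝ᵥ x ≤ bend q d ⬝ᵥ y := by
  obtain ⟨T, hT, hmax⟩ := Set.exists_max_image {T : Finset (Diagonal n) | IsTriangulation T}
    (fun T => w ⬝ᵥ gkzVector q T) (Set.toFinite _) (exists_isTriangulation n)
  have hmax' : ∀ x ∈ gkzAssociahedron q, w ⬝ᵥ x ≤ w ⬝ᵥ gkzVector q T := by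
    intro x hx
    have := le_dotProduct_of_mem (w := -w) hx (m := -(w ⬝ᵥ gkzVector q T)) fun T' hT' => by
      rw [neg_dotProduct]
      exact neg_le_neg (hmax T' hT')
    rw [neg_dotProduct] at this
    linarith
  obtain ⟨α, c, rfl⟩ := exists_eq_affineHeight_add_bends hq hT w
  -- At a maximizing vertex no flip can increase the functional.
  have hc : ∀ d ∈ T, c d ≤ 0 := by
    intro d hd
    obtain ⟨x, hx, r, hr, heq⟩ := exists_flipped_dotProduct hq hT α c hd
    have := hmax' x hx
    by_contra hcd
    have := mul_pos (not_le.1 hcd) hr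
    linarith
  obtain ⟨d, hd, hcd⟩ : ∃ d ∈ T, c d ≠ 0 := by
    by_contra! hall
    obtain ⟨x, hx, y, hy, hne⟩ := h
    have h1 := dotProduct_sub_gkzVector hq hT (α := α) (c := c) hx
    have h2 := dotProduct_sub_gkzVector hq hT (α := α) (c := c) hy
    have hz : ∀ g : Diagonal n → ℝ, ∑ d ∈ T, c d * g d = 0 := fun g =>
      Finset.sum_eq_zero fun d hd => by rw [hall d hd, zero_mul]
    rw [hz] at h1 h2
    exact hne (by linarith)
  refine ⟨d, fun x hx hxmax y hy => ?_⟩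
  have h1 := dotProduct_sub_gkzVector hq hT (α := α) (c := c) hx
  rw [le_antisymm (hmax' x hx) (hxmax _ (gkzVector_mem hT)), sub_self] at h1
  -- On the face of `w` a sum of nonpositive terms is zero, so each term is; a nonzero coefficient
  -- forces the bend of `d` to its minimum.
  have h2 := (Finset.sum_eq_zero_iff_of_nonpos fun d hd => mul_nonpos_of_nonpos_of_nonneg (hc d hd)
    (sub_nonneg.2 (minBendArea_le_dotProduct hq d hx))).1 h1.symm d hd
  have h3 := (mul_eq_zero.1 h2).resolve_left hcd
  have h4 := minBendArea_le_dotProduct hq d hy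
  linarith

/-! ### Rays of the normal cone structure of the secondary polytope -/

/-- The functionals that are maximal on the face of `f` are nonnegative multiples of `f`,
up to constants on `P`. -/
def IsRayFunctional {E : Type*} [AddCommGroup E] [Module ℝ E] (P : Set E)
    (f : Module.Dual ℝ E) : Prop :=
  ∀ g : Module.Dual ℝ E, (∀ x ∈ P, (∀ y ∈ P, f y ≤ f x) → ∀ y ∈ P, g y ≤ g x) →
    ∃ t : ℝ, 0 ≤ t ∧ ∀ x ∈ P, ∀ y ∈ P, g x - g y = t * (f x - f y)

lemma exists_dotProduct_eq (f : Module.Dual ℝ (Fin (n + 3) → ℝ)) : ∃ w, ∀ x, f x = w ⬝ᵥ x := by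
  refine ⟨(dotProductEquiv ℝ (Fin (n + 3))).symm f, fun x => ?_⟩
  rw [← dotProductEquiv_apply_apply, LinearEquiv.apply_symm_apply]

/-- The face of `f` lies in the face where some bend is minimal, so the negative of that bend is
maximal on it and hence a multiple of `f`. -/
lemma exists_bend_of_isRayFunctional (hq : IsConvexPolygon q)
    {f : Module.Dual ℝ (Fin (n + 3) → ℝ)} (hf : IsRayFunctional (gkzAssociahedron q) f)
    (h : ∃ x ∈ gkzAssociahedron q, ∃ y ∈ gkzAssociahedron q, f x ≠ f y) :
    ∃ (d : Diagonal n) (t : ℝ), 0 ≤ t ∧ ∀ x ∈ gkzAssociahedron q, ∀ y ∈ gkzAssociahedron q,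
      bend q d ⬝ᵥ y - bend q d ⬝ᵥ x = t * (f x - f y) := by
  obtain ⟨w, hw⟩ := exists_dotProduct_eq f
  obtain ⟨d, hd⟩ := exists_bend_minimal_on_face hq (w := w) (by simpa only [hw] using h)
  obtain ⟨t, ht, h⟩ := hf (dotProductEquiv ℝ _ (-bend q d)) (by
    intro x hx hmax y hy
    simp only [dotProductEquiv_apply_apply, neg_dotProduct, neg_le_neg_iff]
    exact hd x hx (by simpa only [hw] using hmax) y hy)
  refine ⟨d, t, ht, fun x hx y hy => ?_⟩
  rw [← h x hx y hy]
  simp only [dotProductEquiv_apply_apply, neg_dotProduct]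
  ring

/-- The secondary polytope has no opposite facet normals. -/
lemma not_isRayFunctional_neg (hn : 2 ≤ n) (hq : IsConvexPolygon q)
    {f : Module.Dual ℝ (Fin (n + 3) → ℝ)} (hf : IsRayFunctional (gkzAssociahedron q) f)
    (hf' : IsRayFunctional (gkzAssociahedron q) (-f)) :
    ∀ x ∈ gkzAssociahedron q, ∀ y ∈ gkzAssociahedron q, f x = f y := by
  by_contra! h
  obtain ⟨d, t, ht, hd⟩ := exists_bend_of_isRayFunctional hq hf h
  obtain ⟨e, s, hs, he⟩ := exists_bend_of_isRayFunctional hq hf' (by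
    obtain ⟨x, hx, y, hy, hne⟩ := h
    exact ⟨x, hx, y, hy, by simpa using hne⟩)
  simp only [LinearMap.neg_apply] at he
  -- If `s = 0`, a single bend is constant on the polytope, hence affine. Otherwise `f` is
  -- eliminated from the two relations, which leaves an affine combination of two bends.
  rcases hs.eq_or_lt with rfl | hs
  · obtain ⟨α, hα⟩ := exists_eq_affineHeight_of_const hq (w := bend q e) fun x hx y hy => by
      have := he y hy x hx
      linarith
    exact bend_combination_ne_affineHeight hn hq e e one_pos le_rfl α (by simpa using hα)
  · obtain ⟨α, hα⟩ := exists_eq_affineHeight_of_const hq (w := s • bend q d + t • bend q e)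
      fun x hx y hy => by
        simp only [add_dotProduct, smul_dotProduct, smul_eq_mul]
        have h1 := hd y hy x hx
        have h2 := he y hy x hx
        linear_combination s * h1 + t * h2
    exact bend_combination_ne_affineHeight hn hq d e hs ht α hα

end Decomposition

/-! ### Facets and rays of the normal fan -/

section General

variable {E : Type*} [AddCommGroup E] [Module ℝ E]

lemma vectorSpan_le_ker {P : Set E} {f : Module.Dual ℝ E} (h : ∀ x ∈ P, ∀ y ∈ P, f x = f y) :
    vectorSpan ℝ P ≤ LinearMap.ker f := by
  rw [vectorSpan_def, Submodule.span_le]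
  rintro _ ⟨x, hx, y, hy, rfl⟩
  simp [h x hx y hy]

/-- The directions of a facet and one vector `x - y` leaving it span those of `P`. A functional
constant on the facet is thus determined by its value on `x - y`; the conclusion states this
proportionality to `f` without division. -/
lemma sub_eq_mul_of_facet [FiniteDimensional ℝ E] {P F : Set E} {f : Module.Dual ℝ E}
    (hne : F.Nonempty) (hF : F = {x ∈ P | ∀ y ∈ P, f y ≤ f x})
    (hdim : dimension F + 1 = dimension P) :
    ∃ x ∈ F, ∃ y ∈ P, f y < f x ∧ ∀ g : Module.Dual ℝ E, (∀ x ∈ F, ∀ y ∈ F, g x = g y) →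
      ∀ z ∈ P, ∀ z' ∈ P, (g z - g z') * (f x - f y) = (g x - g y) * (f z - f z') := by
  obtain ⟨x, hx⟩ := hne
  have hFP : F ⊆ P := by rw [hF]; exact Set.sep_subset _ _
  have hxmax : ∀ y ∈ P, f y ≤ f x := by rw [hF] at hx; exact hx.2
  have hfF : ∀ x ∈ F, ∀ y ∈ F, f x = f y := by
    intro x hx y hy
    rw [hF] at hx hy
    exact le_antisymm (hy.2 _ hx.1) (hx.2 _ hy.1)
  obtain ⟨y, hy, hlt⟩ : ∃ y ∈ P, f y < f x := by
    by_contra! h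
    have : F = P := by
      refine hFP.antisymm fun z hz => ?_
      rw [hF]
      exact ⟨hz, fun y hy => (hxmax y hy).trans (h z hz)⟩
    rw [this] at hdim
    omega
  refine ⟨x, hx, y, hy, hlt, fun g hg z hz z' hz' => ?_⟩
  let u := x - y
  have hu : u ∈ vectorSpan ℝ P := vsub_mem_vectorSpan ℝ (hFP hx) hy
  have hfu : 0 < f u := by simp only [u, map_sub]; linarith
  have hspan : vectorSpan ℝ F ⊔ Submodule.span ℝ {u} = vectorSpan ℝ P := by
    refine Submodule.eq_of_le_of_finrank_le
      (sup_le (vectorSpan_mono ℝ hFP) (by simpa using hu)) ?_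
    have hlt : vectorSpan ℝ F < vectorSpan ℝ F ⊔ Submodule.span ℝ {u} := by
      rw [left_lt_sup, Submodule.span_singleton_le_iff_mem]
      intro h
      have := vectorSpan_le_ker hfF h
      rw [LinearMap.mem_ker] at this
      exact hfu.ne' this
    have := Submodule.finrank_lt_finrank_of_lt hlt
    simp only [dimension] at hdim
    omega
  have hmem : z - z' ∈ vectorSpan ℝ F ⊔ Submodule.span ℝ {u} := by
    rw [hspan]
    exact vsub_mem_vectorSpan ℝ hz hz'
  obtain ⟨v, hv, u', hu', hsum⟩ := Submodule.mem_sup.1 hmem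
  obtain ⟨r, rfl⟩ := Submodule.mem_span_singleton.1 hu'
  have h1 : f v = 0 := vectorSpan_le_ker hfF hv
  have h2 : g v = 0 := vectorSpan_le_ker hg hv
  rw [← map_sub, ← map_sub, ← map_sub, ← map_sub, ← hsum]
  simp only [map_add, h1, h2, map_smul, smul_eq_mul, u]
  ring

lemma isRayFunctional_of_facet [FiniteDimensional ℝ E] {P F : Set E} {f : Module.Dual ℝ E}
    (hne : F.Nonempty) (hF : F = {x ∈ P | ∀ y ∈ P, f y ≤ f x})
    (hdim : dimension F + 1 = dimension P) : IsRayFunctional P f := by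
  obtain ⟨x, hx, y, hy, hlt, h⟩ := sub_eq_mul_of_facet hne hF hdim
  intro g hg
  have hxy : 0 < f x - f y := sub_pos.2 hlt
  rw [hF] at hx
  refine ⟨(g x - g y) / (f x - f y), div_nonneg (sub_nonneg.2 (hg x hx.1 hx.2 y hy)) hxy.le, ?_⟩
  intro z hz z' hz'
  have := h g (fun a ha b hb => by
    rw [hF] at ha hb
    exact le_antisymm (hg b hb.1 hb.2 a ha.1) (hg a ha.1 ha.2 b hb.1)) z hz z' hz'
  field_simp
  linarith

lemma IsRayFunctional.of_sub_eq_mul {P : Set E} {f g : Module.Dual ℝ E}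
    (hg : IsRayFunctional P g) {r : ℝ} (hr : 0 < r)
    (h : ∀ x ∈ P, ∀ y ∈ P, g x - g y = r * (f x - f y)) : IsRayFunctional P f := by
  intro k hk
  obtain ⟨t, ht, hkt⟩ := hg k fun x hx hmax => hk x hx fun y hy => by
    have h1 := hmax y hy
    have h2 := h x hx y hy
    by_contra! hc
    have := mul_neg_of_pos_of_neg hr (sub_neg.2 hc)
    linarith
  refine ⟨t * r, mul_nonneg ht hr.le, fun x hx y hy => ?_⟩
  rw [hkt x hx y hy, h x hx y hy, mul_assoc]

/-- A pair of parallel facets has opposite normals. -/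
lemma exists_isRayFunctional_of_parallel [FiniteDimensional ℝ E] {P F G : Set E}
    (h : IsParallelFacetPair P F G) :
    ∃ f : Module.Dual ℝ E, IsRayFunctional P f ∧ IsRayFunctional P (-f) ∧
      ∃ x ∈ P, ∃ y ∈ P, f x ≠ f y := by
  obtain ⟨⟨⟨hFne, f, hF⟩, hFd⟩, ⟨⟨hGne, g, hG⟩, hGd⟩, hne, hpar⟩ := h
  have hdir := hpar.direction_eq
  rw [direction_affineSpan, direction_affineSpan] at hdir
  have hgF : ∀ x ∈ F, ∀ y ∈ F, g x = g y := by
    intro x hx y hy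
    have h1 : x - y ∈ vectorSpan ℝ G := hdir ▸ vsub_mem_vectorSpan ℝ hx hy
    have h2 := vectorSpan_le_ker (f := g) (fun a ha b hb => by
      rw [hG] at ha hb
      exact le_antisymm (hb.2 _ ha.1) (ha.2 _ hb.1)) h1
    rw [LinearMap.mem_ker, map_sub, sub_eq_zero] at h2
    exact h2
  obtain ⟨x, hx, y, hy, hlt, hmul⟩ := sub_eq_mul_of_facet hFne hF hFd
  obtain ⟨x', hx', y', hy', hlt', -⟩ := sub_eq_mul_of_facet hGne hG hGd
  have hFP : F ⊆ P := by rw [hF]; exact Set.sep_subset _ _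
  have hGP : G ⊆ P := by rw [hG]; exact Set.sep_subset _ _
  have hxy : 0 < f x - f y := sub_pos.2 hlt
  have hg : ∀ z ∈ P, ∀ z' ∈ P, g z - g z' = (g x - g y) / (f x - f y) * (f z - f z') := by
    intro z hz z' hz'
    have := hmul g hgF z hz z' hz'
    field_simp
    linarith
  set t := (g x - g y) / (f x - f y)
  refine ⟨f, isRayFunctional_of_facet hFne hF hFd, ?_, x, hFP hx, y, hy, hlt.ne'⟩
  -- On `P` the functional `g` is `t` times `f` up to a constant. Negative `t` is the desired case,
  -- `t = 0` makes `g` constant on `P`, and positive `t` gives `F = G`.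
  rcases lt_trichotomy t 0 with ht | ht | ht
  · refine (isRayFunctional_of_facet hGne hG hGd).of_sub_eq_mul (neg_pos.2 ht) fun a ha b hb => ?_
    rw [hg a ha b hb]
    simp only [LinearMap.neg_apply]
    ring
  · have := hg x' (hGP hx') y' hy'
    rw [ht, zero_mul] at this
    linarith
  · refine absurd ?_ hne
    rw [hF, hG]
    ext z
    refine and_congr_right fun hz => forall₂_congr fun a ha => ?_
    have := hg z hz a ha
    rw [← sub_nonneg, ← sub_nonneg (b := g a), this, mul_nonneg_iff_of_pos_left ht]

/-! ### Opposite rays as an invariant of fans -/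

/-- The ray generated by a vector. -/
def ray (v : E) : Set E :=
  {x | ∃ t : ℝ, 0 ≤ t ∧ x = t • v}

/-- The fan contains two opposite rays. -/
def HasOppositeRays (𝓕 : Set (Set E)) : Prop :=
  ∃ v : E, v ≠ 0 ∧ ray v ∈ 𝓕 ∧ ray (-v) ∈ 𝓕

lemma self_mem_ray (v : E) : v ∈ ray v :=
  ⟨1, zero_le_one, (one_smul ℝ v).symm⟩

lemma image_ray {W : Type*} [AddCommGroup W] [Module ℝ W] (L : E ≃ₗ[ℝ] W) (v : E) :
    L '' ray v = ray (L v) := by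
  ext w
  constructor
  · rintro ⟨_, ⟨t, ht, rfl⟩, rfl⟩
    exact ⟨t, ht, map_smul L t v⟩
  · rintro ⟨t, ht, rfl⟩
    exact ⟨t • v, ⟨t, ht, rfl⟩, map_smul L t v⟩

lemma FansLinearlyIsomorphic.hasOppositeRays_iff {W : Type*} [AddCommGroup W] [Module ℝ W]
    {𝓕 : Set (Set E)} {𝓖 : Set (Set W)} (h : FansLinearlyIsomorphic 𝓕 𝓖) :
    HasOppositeRays 𝓕 ↔ HasOppositeRays 𝓖 := by
  obtain ⟨L, hL⟩ := h
  constructor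
  · rintro ⟨v, hv, h1, h2⟩
    refine ⟨L v, by simpa using hv, ?_, ?_⟩
    · rw [← image_ray]; exact (hL _).1 h1
    · rw [← map_neg, ← image_ray]; exact (hL _).1 h2
  · rintro ⟨w, hw, h1, h2⟩
    refine ⟨L.symm w, by simpa using hw, ?_, ?_⟩
    · rw [hL, image_ray, L.apply_symm_apply]; exact h1
    · rw [hL, image_ray, map_neg, L.apply_symm_apply]; exact h2

lemma domRestrict_mem_normalCone {P F : Set E} {f : Module.Dual ℝ E} (hF : F ⊆ P) :
    f.domRestrict (vectorSpan ℝ P) ∈ normalCone P F ↔ ∀ x ∈ F, ∀ y ∈ P, f y ≤ f x := by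
  constructor
  · intro h x hx y hy
    have := h ⟨x, hF hx⟩ ⟨y, hy⟩ hx
    simp only [LinearMap.domRestrict_apply, vsub_eq_sub, map_sub] at this
    linarith
  · rintro h ⟨x, hx⟩ ⟨y, hy⟩ hxF
    simp only [LinearMap.domRestrict_apply, vsub_eq_sub, map_sub]
    linarith [h x hxF y hy]

lemma exists_domRestrict_eq {V : Submodule ℝ E} (φ : Module.Dual ℝ V) :
    ∃ f : Module.Dual ℝ E, f.domRestrict V = φ :=
  LinearMap.exists_extend φ

lemma domRestrict_eq_of_sub_eq {P : Set E} {f g : Module.Dual ℝ E}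
    (h : ∀ x ∈ P, ∀ y ∈ P, f x - f y = g x - g y) :
    f.domRestrict (vectorSpan ℝ P) = g.domRestrict (vectorSpan ℝ P) := by
  have h0 : vectorSpan ℝ P ≤ LinearMap.ker (f - g) := vectorSpan_le_ker fun x hx y hy => by
    simp only [LinearMap.sub_apply]
    linarith [h x hx y hy]
  ext ⟨z, hz⟩
  have := h0 hz
  rw [LinearMap.mem_ker, LinearMap.sub_apply, sub_eq_zero] at this
  exact this

lemma sub_eq_of_domRestrict_eq {P : Set E} {f g : Module.Dual ℝ E}
    (h : f.domRestrict (vectorSpan ℝ P) = g.domRestrict (vectorSpan ℝ P)) {x y : E} (hx : x ∈ P)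
    (hy : y ∈ P) : f x - f y = g x - g y := by
  have := LinearMap.congr_fun h ⟨x - y, vsub_mem_vectorSpan ℝ hx hy⟩
  simpa using this

/-- If the ray is the normal cone of `F`, then `f` is maximal on `F`. Whatever is maximal on the
whole face of `f` is so on `F`, hence lies in the cone, which is the ray. -/
lemma isRayFunctional_of_ray_mem {P : Set E} {f : Module.Dual ℝ E}
    (hf : f.domRestrict (vectorSpan ℝ P) ≠ 0)
    (h : ray (f.domRestrict (vectorSpan ℝ P)) ∈ normalFan P) : IsRayFunctional P f := by
  obtain ⟨F, ⟨hne, f₀, hF⟩, hcone⟩ := h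
  have hFP : F ⊆ P := by rw [hF]; exact Set.sep_subset _ _
  have h0 : f₀.domRestrict (vectorSpan ℝ P) ∈ normalCone P F :=
    (domRestrict_mem_normalCone hFP).2 fun x hx y hy => by
      rw [hF] at hx
      exact hx.2 y hy
  rw [← hcone] at h0
  obtain ⟨t, ht, h0⟩ := h0
  have hsub : ∀ x ∈ P, ∀ y ∈ P, f₀ x - f₀ y = t * (f x - f y) := by
    intro x hx y hy
    have := sub_eq_of_domRestrict_eq (g := t • f) h0 hx hy
    simp only [LinearMap.smul_apply, smul_eq_mul] at this
    linarith
  have hfmem := self_mem_ray (f.domRestrict (vectorSpan ℝ P))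
  rw [hcone, domRestrict_mem_normalCone hFP] at hfmem
  have htpos : 0 < t := by
    refine ht.lt_of_ne fun h0 => hf ?_
    have hPF : ∀ x ∈ P, x ∈ F := by
      intro x hx
      rw [hF]
      refine ⟨hx, fun y hy => ?_⟩
      have := hsub x hx y hy
      rw [← h0, zero_mul] at this
      linarith
    have := domRestrict_eq_of_sub_eq (P := P) (f := f) (g := 0) fun x hx y hy => by
      have h1 := hfmem x (hPF x hx) y hy
      have h2 := hfmem y (hPF y hy) x hx
      simp only [LinearMap.zero_apply]
      linarith
    rw [this]
    rfl
  intro g hg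
  have hgmem : g.domRestrict (vectorSpan ℝ P) ∈ normalCone P F :=
    (domRestrict_mem_normalCone hFP).2 fun x hx y hy => hg x (hFP hx) (hfmem x hx) y hy
  rw [← hcone] at hgmem
  obtain ⟨s, hs, hgs⟩ := hgmem
  refine ⟨s, hs, fun x hx y hy => ?_⟩
  have := sub_eq_of_domRestrict_eq (g := s • f) hgs hx hy
  simp only [LinearMap.smul_apply, smul_eq_mul] at this
  linarith

lemma exists_isRayFunctional_of_hasOppositeRays {P : Set E}
    (h : HasOppositeRays (normalFan P)) :
    ∃ f : Module.Dual ℝ E, IsRayFunctional P f ∧ IsRayFunctional P (-f) ∧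
      ∃ x ∈ P, ∃ y ∈ P, f x ≠ f y := by
  obtain ⟨φ, hφ, h1, h2⟩ := h
  obtain ⟨f, rfl⟩ := exists_domRestrict_eq φ
  refine ⟨f, isRayFunctional_of_ray_mem hφ h1, isRayFunctional_of_ray_mem ?_ h2, ?_⟩
  · exact neg_ne_zero.2 hφ
  · by_contra! hc
    refine hφ ?_
    have := domRestrict_eq_of_sub_eq (P := P) (f := f) (g := 0) fun x hx y hy => by
      simp [hc x hx y hy]
    rw [this]
    rfl

lemma IsRayFunctional.ray_mem {P : Set E} {f : Module.Dual ℝ E} (hf : IsRayFunctional P f)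
    (hne : {x ∈ P | ∀ y ∈ P, f y ≤ f x}.Nonempty) :
    ray (f.domRestrict (vectorSpan ℝ P)) ∈ normalFan P := by
  refine ⟨_, ⟨hne, f, rfl⟩, ?_⟩
  ext φ
  obtain ⟨g, rfl⟩ := exists_domRestrict_eq φ
  rw [domRestrict_mem_normalCone (Set.sep_subset _ _)]
  constructor
  · rintro ⟨t, ht, hgt⟩ x ⟨hx, hmax⟩ y hy
    have h1 := sub_eq_of_domRestrict_eq (g := t • f) hgt hx hy
    simp only [LinearMap.smul_apply, smul_eq_mul] at h1
    have h2 := mul_le_mul_of_nonneg_left (hmax y hy) ht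
    linarith
  · intro hg
    obtain ⟨t, ht, hgt⟩ := hf g fun x hx hmax => hg x ⟨hx, hmax⟩
    refine ⟨t, ht, domRestrict_eq_of_sub_eq (g := t • f) fun x hx y hy => ?_⟩
    rw [hgt x hx y hy]
    simp only [LinearMap.smul_apply, smul_eq_mul]
    ring

end General

lemma not_hasOppositeRays_gkzAssociahedron {n : ℕ} (hn : 2 ≤ n)
    {q : Fin (n + 3) → EuclideanSpace ℝ (Fin 2)} (hq : IsConvexPolygon q) :
    ¬ HasOppositeRays (normalFan (gkzAssociahedron q)) := by
  intro h
  obtain ⟨f, h1, h2, x, hx, y, hy, hne⟩ := exists_isRayFunctional_of_hasOppositeRays h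
  exact hne (not_isRayFunctional_neg hn hq h1 h2 x hx y hy)

lemma not_isParallelFacetPair_gkzAssociahedron {n : ℕ} (hn : 2 ≤ n)
    {q : Fin (n + 3) → EuclideanSpace ℝ (Fin 2)} (hq : IsConvexPolygon q)
    (F G : Set (Fin (n + 3) → ℝ)) : ¬ IsParallelFacetPair (gkzAssociahedron q) F G := by
  intro h
  obtain ⟨f, h1, h2, x, hx, y, hy, hne⟩ := exists_isRayFunctional_of_parallel h
  exact hne (not_isRayFunctional_neg hn hq h1 h2 x hx y hy)

/-! ### Opposite rays of the Santos fans -/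

lemma santosCone_singleton {n : ℕ} (T₀ : Finset (Diagonal n)) (d : Diagonal n) :
    santosCone T₀ {d} = ray (santosVector T₀ d) := by
  ext x
  constructor
  · rintro ⟨c, hc, rfl⟩
    exact ⟨c d, hc d, by simp⟩
  · rintro ⟨t, ht, rfl⟩
    exact ⟨fun _ => t, fun _ => ht, by simp⟩

lemma ray_santosVector_mem {n : ℕ} (T₀ : Finset (Diagonal n)) (d : Diagonal n) :
    ray (santosVector T₀ d) ∈ santosFan T₀ := by
  refine ⟨{d}, ?_, (santosCone_singleton T₀ d).symm⟩
  intro a ha b hb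
  rw [Finset.mem_singleton] at ha hb
  subst ha hb
  exact not_crosses_self _

/-- The diagonal that replaces `d` in a flip crosses no diagonal of the seed but `d`, so its vector
is `α d`, the opposite of the vector of `d`. -/
lemma IsTriangulation.hasOppositeRays_santosFan {n : ℕ} (hn : 1 ≤ n) {T₀ : Finset (Diagonal n)}
    (hT : IsTriangulation T₀) : HasOppositeRays (santosFan T₀) := by
  obtain ⟨d, hd⟩ : T₀.Nonempty := by
    rw [Finset.nonempty_iff_ne_empty]
    rintro rfl
    -- For `n ≥ 1` the pair 0, 2 is a diagonal, so the empty set is not maximal.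
    refine Finset.notMem_empty _ (hT.2 ⟨(⟨0, by omega⟩, ⟨2, by omega⟩), ?_, ?_⟩ (by simp))
    · simp [Fin.lt_def]
    · simp only [IsSide]; omega
  obtain ⟨d', hc, hu⟩ := hT.exists_flip hd
  have hd' : d' ∉ T₀ := fun h => hT.1 d' h d hd hc
  have hneg : santosVector T₀ d' = -santosVector T₀ d := by
    funext ⟨e, he⟩
    simp only [santosVector, hd, hd', if_true, if_false, Pi.neg_apply]
    by_cases h : d = e
    · subst h
      simp [hc]
    · have : ¬ Crosses d' e := fun hce => h (hu e he hce).symm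
      simp [h, this]
  refine ⟨santosVector T₀ d, ?_, ray_santosVector_mem T₀ d, hneg ▸ ray_santosVector_mem T₀ d'⟩
  intro h0
  have := congrFun h0 ⟨d, hd⟩
  simp [santosVector, hd] at this

/-! ### Opposite rays of the Hohlweg--Lange fans -/

section HohlwegLange

variable {n : ℕ} {σ : Fin (n - 1) → Bool}

lemma hlHeight_of_true {k : Fin (n + 3)} (h : hlSign σ k = true) :
    hlHeight σ k = 1 + (k : ℝ) * ((n : ℝ) + 2 - (k : ℝ)) := by
  simp [hlHeight, h]

lemma hlHeight_of_false {k : Fin (n + 3)} (h : hlSign σ k = false) :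
    hlHeight σ k = -(1 + (k : ℝ) * ((n : ℝ) + 2 - (k : ℝ))) := by
  simp [hlHeight, h]

lemma hlSign_zero : hlSign σ 0 = true := by
  simp [hlSign]

lemma hlSign_last : hlSign σ (Fin.last (n + 2)) = true := by
  simp [hlSign]

lemma hlSign_of_eq_one {k : Fin (n + 3)} (hk : (k : ℕ) = 1) : hlSign σ k = false := by
  simp [hlSign, hk]

lemma hlSign_of_eq_add_one {k : Fin (n + 3)} (hk : (k : ℕ) = n + 1) : hlSign σ k = false := by
  simp [hlSign, hk]

lemma hlOffset_left (i j : Fin (n + 3)) : hlOffset σ i j i = 0 := by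
  simp [hlOffset]

lemma hlOffset_right (i j : Fin (n + 3)) : hlOffset σ i j j = 0 := by
  simp [hlOffset]

lemma mem_hlBelow {i j k : Fin (n + 3)} : k ∈ hlBelow σ i j ↔ hlOffset σ i j k < 0 := by
  simp [hlBelow]

lemma mem_hlSet {i j k : Fin (n + 3)} : k ∈ hlSet σ i j ↔
    (k ∈ hlBelow σ i j ∧ k ≠ 0 ∧ k ≠ Fin.last (n + 2)) ∨ (0 ∈ hlBelow σ i j ∧ k = i) ∨
      (Fin.last (n + 2) ∈ hlBelow σ i j ∧ k = j) := by
  unfold hlSet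
  split_ifs with h1 h2 h2 <;> simp [h1, h2] <;> tauto

lemma ne_of_mem_hlSet {i j k : Fin (n + 3)} (hij : i < j) (hk : k ∈ hlSet σ i j) :
    k ≠ 0 ∧ k ≠ Fin.last (n + 2) := by
  rcases mem_hlSet.1 hk with h | ⟨h, rfl⟩ | ⟨h, rfl⟩
  · exact h.2
  · refine ⟨?_, (hij.trans_le (Fin.le_last j)).ne⟩
    rintro rfl
    rw [mem_hlBelow, hlOffset_left] at h
    exact lt_irrefl _ h
  · refine ⟨((Fin.zero_le i).trans_lt hij).ne', ?_⟩
    rintro rfl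
    rw [mem_hlBelow, hlOffset_right] at h
    exact lt_irrefl _ h

/-- The coordinates with labels in the set of the pair `ij`. -/
def hlCoords (σ : Fin (n - 1) → Bool) (i j : Fin (n + 3)) : Finset (Fin (n + 1)) :=
  Finset.univ.filter fun m : Fin (n + 1) => m.succ.castSucc ∈ hlSet σ i j

lemma card_hlCoords {i j : Fin (n + 3)} (hij : i < j) :
    (hlSet σ i j).card = (hlCoords σ i j).card := by
  symm
  refine Finset.card_nbij (fun m => m.succ.castSucc) ?_ ?_ ?_
  · intro m hm
    simpa [hlCoords] using hm
  · intro a _ b _ h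
    simpa using h
  · intro k hk
    have h := ne_of_mem_hlSet hij hk
    have h2 := k.2
    have h0 : (k : ℕ) ≠ 0 := fun h' => h.1 (Fin.ext h')
    have h1 : (k : ℕ) ≠ n + 2 := fun h' => h.2 (Fin.ext h')
    have heq : (⟨(k : ℕ) - 1, by omega⟩ : Fin (n + 1)).succ.castSucc = k := by
      apply Fin.ext
      simp only [Fin.val_castSucc, Fin.val_succ]
      omega
    refine ⟨⟨(k : ℕ) - 1, by omega⟩, ?_, heq⟩
    simp only [hlCoords, Finset.coe_filter, Finset.mem_univ, true_and]
    show _ ∈ hlSet σ i j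
    rw [heq]
    exact hk

lemma mem_hlAssociahedron {x : Fin (n + 1) → ℝ} : x ∈ hlAssociahedron σ ↔
    (∀ i j, IsHLDiagonal σ i j → ((hlCoords σ i j).card : ℝ) * ((hlCoords σ i j).card + 1) / 2 ≤
      ∑ m ∈ hlCoords σ i j, x m) ∧ ∑ m, x m = ((n : ℝ) + 1) * ((n : ℝ) + 2) / 2 := by
  refine and_congr_left fun _ => forall_congr' fun i => forall_congr' fun j =>
    forall_congr' fun hij => ?_
  rw [card_hlCoords hij.1]
  rfl

/-- The diagonal from `0` to the second lower vertex has only the vertex `1` below it. -/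
lemma exists_hlCoords_eq_singleton (hn : 2 ≤ n) :
    ∃ i j, IsHLDiagonal σ i j ∧ hlCoords σ i j = {0} := by
  let s : Finset (Fin (n + 3)) := Finset.univ.filter fun k => 2 ≤ (k : ℕ) ∧ hlSign σ k = false
  have hs : s.Nonempty := by
    refine ⟨⟨n + 1, by omega⟩, ?_⟩
    simp only [s, Finset.mem_filter, Finset.mem_univ, true_and]
    exact ⟨by omega, hlSign_of_eq_add_one rfl⟩
  obtain ⟨b, hb, hmin⟩ := s.exists_min_image id hs
  simp only [s, Finset.mem_filter, Finset.mem_univ, true_and, id] at hb hmin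
  obtain ⟨hb2, hbs⟩ := hb
  have hbR : (2 : ℝ) ≤ (b : ℝ) := by exact_mod_cast hb2
  have hle : ∀ k : Fin (n + 3), (k : ℝ) ≤ (n : ℝ) + 2 := by
    intro k
    have := k.2
    have : (k : ℕ) ≤ n + 2 := by omega
    exact_mod_cast this
  -- Along the lower chain the offset has the sign of `k - b`, so only the vertices preceding `b`
  -- lie below; upper vertices other than 0 lie above.
  have hfalse : ∀ k : Fin (n + 3), hlSign σ k = false →
      hlOffset σ 0 b k = ((k : ℝ) - b) * (2 + b * k) := by
    intro k hk
    simp only [hlOffset, hlHeight_of_false hk, hlHeight_of_false hbs, hlHeight_of_true hlSign_zero,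
      Fin.val_zero, Nat.cast_zero]
    ring
  have htrue : ∀ k : Fin (n + 3), hlSign σ k = true → 0 < (k : ℕ) → 0 < hlOffset σ 0 b k := by
    intro k hk hk0
    have h1 : hlOffset σ 0 b k =
        b * (k * ((n : ℝ) + 2 - k)) + (2 + b * ((n : ℝ) + 2 - b)) * k := by
      simp only [hlOffset, hlHeight_of_true hk, hlHeight_of_false hbs,
        hlHeight_of_true hlSign_zero, Fin.val_zero, Nat.cast_zero]
      ring
    have h2 : (0 : ℝ) < k := by exact_mod_cast hk0
    have h3 : 0 ≤ (n : ℝ) + 2 - k := sub_nonneg.2 (hle k)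
    have h4 : 0 ≤ (n : ℝ) + 2 - b := sub_nonneg.2 (hle b)
    rw [h1]
    positivity
  have hbelow : ∀ k, k ∈ hlBelow σ 0 b ↔ (k : ℕ) = 1 := by
    intro k
    rw [mem_hlBelow]
    constructor
    · intro h
      have hk0 : (k : ℕ) ≠ 0 := by
        intro hk
        have : k = 0 := Fin.ext hk
        rw [this, hlOffset_left] at h
        exact lt_irrefl _ h
      cases hks : hlSign σ k
      · by_contra hk1
        have hbk : b ≤ k := hmin k ⟨by omega, hks⟩
        rw [hfalse k hks] at h
        have h1 : (b : ℝ) ≤ k := by exact_mod_cast hbk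
        have : 0 ≤ ((k : ℝ) - b) * (2 + b * k) := by
          have : 0 ≤ (k : ℝ) - b := sub_nonneg.2 h1
          positivity
        linarith
      · have := htrue k hks (by omega)
        linarith
    · intro hk
      rw [hfalse k (hlSign_of_eq_one hk), hk]
      push_cast
      have : (0 : ℝ) < 2 + b * 1 := by linarith
      exact mul_neg_of_neg_of_pos (by linarith) this
  refine ⟨0, b, ⟨by rw [Fin.lt_def, Fin.val_zero]; omega, ⟨⟨1, by omega⟩, ?_⟩,
    ⟨Fin.last (n + 2), htrue _ hlSign_last (by simp)⟩⟩, ?_⟩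
  · exact mem_hlBelow.1 ((hbelow _).2 rfl)
  · ext m
    simp only [hlCoords, Finset.mem_filter, Finset.mem_univ, true_and, mem_hlSet, hbelow,
      Finset.mem_singleton, Fin.ext_iff, Fin.val_castSucc, Fin.val_succ, Fin.val_zero,
      Fin.val_last, ne_eq]
    omega

/-- The diagonal from `1` to the second upper vertex has all labels but `1` in its set. -/
lemma exists_hlCoords_eq_erase (hn : 2 ≤ n) :
    ∃ i j, IsHLDiagonal σ i j ∧ hlCoords σ i j = Finset.univ.erase 0 := by
  let s : Finset (Fin (n + 3)) := Finset.univ.filter fun k => 2 ≤ (k : ℕ) ∧ hlSign σ k = true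
  have hs : s.Nonempty := by
    refine ⟨Fin.last (n + 2), ?_⟩
    simp only [s, Finset.mem_filter, Finset.mem_univ, true_and]
    exact ⟨by simp, hlSign_last⟩
  obtain ⟨u, hu, hmin⟩ := s.exists_min_image id hs
  simp only [s, Finset.mem_filter, Finset.mem_univ, true_and, id] at hu hmin
  obtain ⟨hu2, hus⟩ := hu
  obtain ⟨o, ho⟩ : ∃ o : Fin (n + 3), (o : ℕ) = 1 := ⟨⟨1, by omega⟩, rfl⟩
  have hos : hlSign σ o = false := hlSign_of_eq_one ho
  have huR : (2 : ℝ) ≤ (u : ℝ) := by exact_mod_cast hu2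
  have hle : ∀ k : Fin (n + 3), (k : ℝ) ≤ (n : ℝ) + 2 := by
    intro k
    have := k.2
    have : (k : ℕ) ≤ n + 2 := by omega
    exact_mod_cast this
  have hfalse : ∀ k : Fin (n + 3), hlSign σ k = false → 1 < (k : ℕ) →
      hlOffset σ o u k < 0 := by
    intro k hk hk1
    have h1 : hlOffset σ o u k = -(((k : ℝ) - 1) *
        (((n : ℝ) + 2 - 1 - k) * (u - 1) + (1 + u) * ((n : ℝ) + 2 + 1 - u))) := by
      simp only [hlOffset, hlHeight_of_false hk, hlHeight_of_false hos, hlHeight_of_true hus, ho,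
        Nat.cast_one]
      ring
    have hk2 : (k : ℕ) ≠ n + 2 := by
      intro h
      have : k = Fin.last (n + 2) := Fin.ext h
      rw [this, hlSign_last] at hk
      exact Bool.noConfusion hk
    have hk3 : (k : ℕ) + 1 ≤ n + 2 := by omega
    have hk4 : (k : ℝ) + 1 ≤ (n : ℝ) + 2 := by exact_mod_cast hk3
    have hk5 : (1 : ℝ) < k := by exact_mod_cast hk1
    have a1 : 0 < (k : ℝ) - 1 := by linarith
    have a2 : 0 ≤ (n : ℝ) + 2 - 1 - k := by linarith
    have a3 : 0 ≤ (u : ℝ) - 1 := by linarith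
    have a4 : 0 < (n : ℝ) + 2 + 1 - u := by linarith [hle u]
    rw [h1, neg_lt_zero]
    positivity
  have htrue : ∀ k : Fin (n + 3), hlSign σ k = true →
      ∃ r > 0, hlOffset σ o u k = ((u : ℝ) - k) * r := by
    intro k hk
    refine ⟨2 * ((n : ℝ) + 2) + 1 + k * u - k - u, ?_, ?_⟩
    · have : (0 : ℝ) ≤ (k : ℝ) * u := by positivity
      have := hle k
      have := hle u
      linarith
    · simp only [hlOffset, hlHeight_of_true hk, hlHeight_of_false hos, hlHeight_of_true hus, ho,
        Nat.cast_one]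
      ring
  have hzero : 0 < hlOffset σ o u 0 := by
    obtain ⟨r, hr, h⟩ := htrue 0 hlSign_zero
    rw [h]
    simp only [Fin.val_zero, Nat.cast_zero, sub_zero]
    exact mul_pos (by linarith) hr
  have hbelow : ∀ k, k ∈ hlBelow σ o u ↔ 2 ≤ (k : ℕ) ∧ (k : ℕ) ≠ u := by
    intro k
    rw [mem_hlBelow]
    constructor
    · intro h
      have h0 : (k : ℕ) ≠ 0 := by
        intro hk
        have : k = 0 := Fin.ext hk
        rw [this] at h
        linarith
      have h1 : (k : ℕ) ≠ 1 := by
        intro hk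
        have : k = o := Fin.ext (hk.trans ho.symm)
        rw [this, hlOffset_left] at h
        exact lt_irrefl _ h
      refine ⟨by omega, fun hku => ?_⟩
      have : k = u := Fin.ext hku
      rw [this, hlOffset_right] at h
      exact lt_irrefl _ h
    · rintro ⟨h2, hne⟩
      cases hks : hlSign σ k
      · exact hfalse k hks (by omega)
      · have huk : u ≤ k := hmin k ⟨h2, hks⟩
        have hlt : (u : ℕ) < k := by omega
        obtain ⟨r, hr, h⟩ := htrue k hks
        rw [h]
        have : (u : ℝ) < k := by exact_mod_cast hlt
        exact mul_neg_of_neg_of_pos (by linarith) hr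
  refine ⟨o, u, ⟨by rw [Fin.lt_def]; omega, ⟨⟨n + 1, by omega⟩, ?_⟩, ⟨0, hzero⟩⟩, ?_⟩
  · exact hfalse _ (hlSign_of_eq_add_one rfl) (by simp only; omega)
  -- The vertex `u` itself is not below the diagonal. If `u` is not the last vertex, then the last
  -- one is below and its replacement by `u` supplies the missing label. The vertex 0 lies above, so
  -- the label 1 is not added.
  · ext m
    have hm := m.2
    have hul := u.2
    simp only [hlCoords, Finset.mem_filter, Finset.mem_univ, true_and, mem_hlSet, hbelow,
      Finset.mem_erase, and_true, Fin.ext_iff, Fin.val_castSucc, Fin.val_succ, Fin.val_zero,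
      Fin.val_last, ne_eq]
    omega

lemma one_le_of_mem_hlAssociahedron (hn : 2 ≤ n) {x : Fin (n + 1) → ℝ}
    (hx : x ∈ hlAssociahedron σ) : 1 ≤ x 0 := by
  obtain ⟨i, j, hd, hc⟩ := exists_hlCoords_eq_singleton (σ := σ) hn
  have := (mem_hlAssociahedron.1 hx).1 i j hd
  rw [hc] at this
  norm_num at this
  exact this

lemma le_of_mem_hlAssociahedron (hn : 2 ≤ n) {x : Fin (n + 1) → ℝ}
    (hx : x ∈ hlAssociahedron σ) : x 0 ≤ (n : ℝ) + 1 := by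
  obtain ⟨i, j, hd, hc⟩ := exists_hlCoords_eq_erase (σ := σ) hn
  obtain ⟨h1, h2⟩ := mem_hlAssociahedron.1 hx
  have := h1 i j hd
  rw [hc, Finset.card_erase_of_mem (Finset.mem_univ 0), Finset.card_univ, Fintype.card_fin,
    Nat.add_sub_cancel] at this
  rw [← Finset.add_sum_erase _ _ (Finset.mem_univ (0 : Fin (n + 1)))] at h2
  linarith

/-! ### Relative interior points of two facets -/

/-- The point with one coordinate `a` and all others `b`. -/
def twoValued (n : ℕ) (a b : ℝ) (m : Fin (n + 1)) : ℝ :=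
  if m = 0 then a else b

lemma sum_twoValued_of_mem {S : Finset (Fin (n + 1))} (h : 0 ∈ S) (a b : ℝ) :
    ∑ m ∈ S, twoValued n a b m = a + ((S.card : ℝ) - 1) * b := by
  rw [← Finset.add_sum_erase _ _ h, Finset.sum_congr rfl (g := fun _ => b), Finset.sum_const,
    Finset.card_erase_of_mem h, nsmul_eq_mul, Nat.cast_pred (Finset.card_pos.2 ⟨0, h⟩)]
  · simp [twoValued]
  · intro m hm
    simp [twoValued, Finset.ne_of_mem_erase hm]

lemma sum_twoValued_of_notMem {S : Finset (Fin (n + 1))} (h : 0 ∉ S) (a b : ℝ) :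
    ∑ m ∈ S, twoValued n a b m = S.card * b := by
  rw [Finset.sum_congr rfl (g := fun _ => b), Finset.sum_const, nsmul_eq_mul]
  intro m hm
  have : m ≠ 0 := fun h0 => h (h0 ▸ hm)
  simp [twoValued, this]

/-- The point `p` of the hyperplane of the permutahedron satisfies all its inequalities strictly,
up to the one of `S₀`, which it satisfies. -/
def IsRelInteriorPoint (n : ℕ) (S₀ : Finset (Fin (n + 1))) (p : Fin (n + 1) → ℝ) : Prop :=
  ∑ m, p m = ((n : ℝ) + 1) * ((n : ℝ) + 2) / 2 ∧
    (S₀.card : ℝ) * (S₀.card + 1) / 2 ≤ ∑ m ∈ S₀, p m ∧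
    ∀ S : Finset (Fin (n + 1)), S = ∅ ∨ S = Finset.univ ∨ S = S₀ ∨
      (S.card : ℝ) * (S.card + 1) / 2 < ∑ m ∈ S, p m

/-- The finitely many strict inequalities survive small moves, and those of `∅`, `univ` and `S₀` do
not notice the move. Imposing the inequality for every subset, as for the permutahedron, makes the
argument independent of `σ`. -/
lemma IsRelInteriorPoint.eventually_mem {S₀ : Finset (Fin (n + 1))} {p u : Fin (n + 1) → ℝ}
    (hp : IsRelInteriorPoint n S₀ p) (hu : ∑ m, u m = 0) (hu₀ : ∑ m ∈ S₀, u m = 0) :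
    ∀ᶠ ε in nhds (0 : ℝ), p + ε • u ∈ hlAssociahedron σ := by
  obtain ⟨h1, h2, h3⟩ := hp
  have hsum : ∀ (S : Finset (Fin (n + 1))) (ε : ℝ),
      ∑ m ∈ S, (p + ε • u) m = ∑ m ∈ S, p m + ε * ∑ m ∈ S, u m := by
    intro S ε
    simp [Finset.sum_add_distrib, Finset.mul_sum]
  have hev : ∀ᶠ ε in nhds (0 : ℝ), ∀ S : Finset (Fin (n + 1)),
      (S.card : ℝ) * (S.card + 1) / 2 ≤ ∑ m ∈ S, (p + ε • u) m := by
    rw [Filter.eventually_all]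
    intro S
    simp only [hsum]
    rcases h3 S with rfl | rfl | rfl | h
    · simp
    · refine Filter.Eventually.of_forall fun ε => ?_
      rw [hu, h1, Finset.card_univ, Fintype.card_fin]
      push_cast
      linarith
    · refine Filter.Eventually.of_forall fun ε => ?_
      rw [hu₀, mul_zero, add_zero]
      exact h2
    · have hc : Continuous fun ε : ℝ => ∑ m ∈ S, p m + ε * ∑ m ∈ S, u m := by fun_prop
      have := hc.tendsto 0
      rw [zero_mul, add_zero] at this
      filter_upwards [this.eventually (lt_mem_nhds h)] with ε hε
      exact hε.le
  filter_upwards [hev] with ε hε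
  refine mem_hlAssociahedron.2 ⟨fun i j _ => hε _, ?_⟩
  rw [hsum, hu, h1, mul_zero, add_zero]

lemma IsRelInteriorPoint.mem {S₀ : Finset (Fin (n + 1))} {p : Fin (n + 1) → ℝ}
    (hp : IsRelInteriorPoint n S₀ p) : p ∈ hlAssociahedron σ := by
  have := (hp.eventually_mem (σ := σ) (u := 0) (by simp) (by simp)).self_of_nhds
  simpa using this

/-- The barycenter of the facet x₁ = 1 of the permutahedron; (n + 3)/2 is the mean of 2, …, n + 1.
With k the size of `S`, the slack is (k − 1)(n + 1 − k)/2 or k(n + 2 − k)/2, according to whether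
`S` contains the first coordinate. -/
lemma isRelInteriorPoint_low (hn : 1 ≤ n) :
    IsRelInteriorPoint n {0} (twoValued n 1 (((n : ℝ) + 3) / 2)) := by
  have hnR : (1 : ℝ) ≤ n := by exact_mod_cast hn
  refine ⟨?_, ?_, fun S => ?_⟩
  · rw [sum_twoValued_of_mem (Finset.mem_univ 0), Finset.card_univ, Fintype.card_fin]
    push_cast
    ring
  · simp [twoValued]
  · by_cases h : 0 ∈ S
    · by_cases hS : S = Finset.univ
      · exact Or.inr (Or.inl hS)
      by_cases hS' : S = {0}
      · exact Or.inr (Or.inr (Or.inl hS'))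
      refine Or.inr (Or.inr (Or.inr ?_))
      rw [sum_twoValued_of_mem h]
      have h1 : S.card < n + 1 := by
        have := Finset.card_lt_card (Finset.ssubset_univ_iff.2 hS)
        simpa using this
      have h2 : 1 < S.card := by
        by_contra hc
        have h1 : S.card = 1 := le_antisymm (not_lt.1 hc) (Finset.card_pos.2 ⟨0, h⟩)
        obtain ⟨a, rfl⟩ := Finset.card_eq_one.1 h1
        rw [Finset.mem_singleton] at h
        exact hS' (by rw [h])
      have h1' : (S.card : ℝ) + 1 ≤ n + 1 := by exact_mod_cast h1
      have h2' : (1 : ℝ) < S.card := by exact_mod_cast h2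
      have : 0 < ((S.card : ℝ) - 1) * ((n : ℝ) + 1 - S.card) :=
        mul_pos (by linarith) (by linarith)
      linarith
    · by_cases hS : S = ∅
      · exact Or.inl hS
      refine Or.inr (Or.inr (Or.inr ?_))
      rw [sum_twoValued_of_notMem h]
      have h1 : S.card < n + 1 := by
        have := Finset.card_lt_univ_of_notMem h
        simpa using this
      have h2 : 0 < S.card := Finset.card_pos.2 (Finset.nonempty_iff_ne_empty.2 hS)
      have h1' : (S.card : ℝ) + 1 ≤ n + 1 := by exact_mod_cast h1
      have h2' : (0 : ℝ) < S.card := by exact_mod_cast h2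
      have : 0 < (S.card : ℝ) * ((n : ℝ) + 2 - S.card) := mul_pos h2' (by linarith)
      linarith

/-- The barycenter of the opposite facet x₁ = n + 1; (n + 1)/2 is the mean of 1, …, n. The slacks
are now (k + 1)(n + 1 − k)/2 and k(n − k)/2. -/
lemma isRelInteriorPoint_high :
    IsRelInteriorPoint n (Finset.univ.erase 0) (twoValued n ((n : ℝ) + 1) (((n : ℝ) + 1) / 2)) := by
  have hcard : (Finset.univ.erase (0 : Fin (n + 1))).card = n := by
    rw [Finset.card_erase_of_mem (Finset.mem_univ 0), Finset.card_univ, Fintype.card_fin,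
      Nat.add_sub_cancel]
  refine ⟨?_, ?_, fun S => ?_⟩
  · rw [sum_twoValued_of_mem (Finset.mem_univ 0), Finset.card_univ, Fintype.card_fin]
    push_cast
    ring
  · rw [sum_twoValued_of_notMem (Finset.notMem_erase 0 _), hcard]
    linarith
  · by_cases h : 0 ∈ S
    · by_cases hS : S = Finset.univ
      · exact Or.inr (Or.inl hS)
      refine Or.inr (Or.inr (Or.inr ?_))
      rw [sum_twoValued_of_mem h]
      have h1 : S.card < n + 1 := by
        have := Finset.card_lt_card (Finset.ssubset_univ_iff.2 hS)
        simpa using this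
      have h1' : (S.card : ℝ) + 1 ≤ n + 1 := by exact_mod_cast h1
      have : 0 < ((S.card : ℝ) + 1) * ((n : ℝ) + 1 - S.card) :=
        mul_pos (by positivity) (by linarith)
      linarith
    · by_cases hS : S = ∅
      · exact Or.inl hS
      by_cases hS' : S = Finset.univ.erase 0
      · exact Or.inr (Or.inr (Or.inl hS'))
      refine Or.inr (Or.inr (Or.inr ?_))
      rw [sum_twoValued_of_notMem h]
      have h1 : S.card < n := by
        have hsub : S ⊆ Finset.univ.erase 0 := fun m hm =>
          Finset.mem_erase.2 ⟨fun h0 => h (h0 ▸ hm), Finset.mem_univ m⟩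
        exact (Finset.card_lt_card (hsub.ssubset_of_ne hS')).trans_eq hcard
      have h2 : 0 < S.card := Finset.card_pos.2 (Finset.nonempty_iff_ne_empty.2 hS)
      have h1' : (S.card : ℝ) + 1 ≤ n := by exact_mod_cast h1
      have h2' : (0 : ℝ) < S.card := by exact_mod_cast h2
      have : 0 < (S.card : ℝ) * ((n : ℝ) - S.card) := mul_pos h2' (by linarith)
      linarith

/-- A functional whose face has a point in its relative interior. -/
lemma isRayFunctional_of_isRelInteriorPoint {f : Module.Dual ℝ (Fin (n + 1) → ℝ)}
    {S₀ : Finset (Fin (n + 1))} {p p' : Fin (n + 1) → ℝ} (hp : IsRelInteriorPoint n S₀ p)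
    (hmax : ∀ y ∈ hlAssociahedron σ, f y ≤ f p) (hp' : p' ∈ hlAssociahedron σ) (hlt : f p' < f p)
    (hf : ∀ u : Fin (n + 1) → ℝ, ∑ m, u m = 0 → f u = 0 → ∑ m ∈ S₀, u m = 0) :
    IsRayFunctional (hlAssociahedron σ) f := by
  intro g hg
  have hpmem : p ∈ hlAssociahedron σ := hp.mem
  have hgp := hg p hpmem hmax
  -- Since `g` is maximal at `p` and one can move from `p` both ways along `u`, `g` vanishes on all
  -- directions of the hyperplane that `f` kills.
  have hgu : ∀ u : Fin (n + 1) → ℝ, ∑ m, u m = 0 → f u = 0 → g u = 0 := by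
    have hle : ∀ u : Fin (n + 1) → ℝ, ∑ m, u m = 0 → f u = 0 → g u ≤ 0 := by
      intro u hu hfu
      have hev := hp.eventually_mem (σ := σ) hu (hf u hu hfu)
      obtain ⟨ε, hε, hpos⟩ := ((hev.filter_mono nhdsWithin_le_nhds).and
        (self_mem_nhdsWithin (s := Set.Ioi (0 : ℝ)))).exists
      have h1 := hgp _ hε
      rw [map_add, map_smul, smul_eq_mul] at h1
      by_contra! hc
      have := mul_pos hpos hc
      linarith
    intro u hu hfu
    refine le_antisymm (hle u hu hfu) ?_
    have := hle (-u) (by simp [hu]) (by simp [hfu])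
    rw [map_neg] at this
    linarith
  have hpos : 0 < f p - f p' := sub_pos.2 hlt
  refine ⟨(g p - g p') / (f p - f p'), div_nonneg (sub_nonneg.2 (hgp p' hp')) hpos.le, ?_⟩
  intro x hx y hy
  have hsum : ∀ x ∈ hlAssociahedron σ, ∑ m, x m = ((n : ℝ) + 1) * ((n : ℝ) + 2) / 2 :=
    fun x hx => (mem_hlAssociahedron.1 hx).2
  -- This combination of differences has coordinate sum zero and is killed by `f`, so `g` is
  -- proportional to `f`, with the factor read off from `p` and `p'`.
  have h := hgu ((f p - f p') • (x - y) - (f x - f y) • (p - p'))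
    (by simp [Finset.sum_sub_distrib, ← Finset.mul_sum, hsum x hx, hsum y hy, hsum p hpmem,
      hsum p' hp'])
    (by simp only [map_sub, map_smul, smul_eq_mul]; ring)
  simp only [map_sub, map_smul, smul_eq_mul] at h
  field_simp
  linarith

lemma hasOppositeRays_hlAssociahedron (hn : 2 ≤ n) (σ : Fin (n - 1) → Bool) :
    HasOppositeRays (normalFan (hlAssociahedron σ)) := by
  have hnR : (2 : ℝ) ≤ n := by exact_mod_cast hn
  let f : Module.Dual ℝ (Fin (n + 1) → ℝ) := LinearMap.proj 0
  have hlow := isRelInteriorPoint_low (n := n) (by omega)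
  have hhigh := isRelInteriorPoint_high (n := n)
  set a := twoValued n 1 (((n : ℝ) + 3) / 2) with ha
  set b := twoValued n ((n : ℝ) + 1) (((n : ℝ) + 1) / 2) with hb
  have ha0 : f a = 1 := by simp [f, ha, twoValued]
  have hb0 : f b = (n : ℝ) + 1 := by simp [f, hb, twoValued]
  have hmaxb : ∀ y ∈ hlAssociahedron σ, f y ≤ f b := fun y hy => by
    rw [hb0]; exact le_of_mem_hlAssociahedron hn hy
  have hmaxa : ∀ y ∈ hlAssociahedron σ, (-f) y ≤ (-f) a := fun y hy => by
    rw [LinearMap.neg_apply, LinearMap.neg_apply, ha0]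
    exact neg_le_neg (one_le_of_mem_hlAssociahedron hn hy)
  have hray : IsRayFunctional (hlAssociahedron σ) f := by
    refine isRayFunctional_of_isRelInteriorPoint hhigh hmaxb hlow.mem (by rw [ha0, hb0]; linarith) ?_
    intro u hu hfu
    rw [← Finset.add_sum_erase _ _ (Finset.mem_univ (0 : Fin (n + 1)))] at hu
    have : u 0 = 0 := hfu
    linarith
  have hray' : IsRayFunctional (hlAssociahedron σ) (-f) := by
    refine isRayFunctional_of_isRelInteriorPoint hlow hmaxa hhigh.mem
      (by rw [LinearMap.neg_apply, LinearMap.neg_apply, ha0, hb0]; linarith) ?_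
    intro u _ hfu
    rw [LinearMap.neg_apply, neg_eq_zero] at hfu
    rw [Finset.sum_singleton]
    exact hfu
  refine ⟨f.domRestrict _, ?_, hray.ray_mem ⟨b, hhigh.mem, hmaxb⟩,
    hray'.ray_mem ⟨a, hlow.mem, hmaxa⟩⟩
  intro h0
  have := sub_eq_of_domRestrict_eq (P := hlAssociahedron σ) (f := f) (g := 0) h0
    hhigh.mem hlow.mem
  simp only [LinearMap.zero_apply, ha0, hb0] at this
  linarith

end HohlwegLange

end Associahedra

end

theorem mainTheorem6 (n : ℕ) (hn : 2 ≤ n) (q : Fin (n + 3) → EuclideanSpace ℝ (Fin 2))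
    (hq : Associahedra.IsConvexPolygon q) :
    (¬ ∃ F G : Set (Fin (n + 3) → ℝ),
      Associahedra.IsParallelFacetPair (Associahedra.gkzAssociahedron q) F G) ∧
    (∀ σ : Fin (n - 1) → Bool,
      ¬ Associahedra.NormallyIsomorphic (Associahedra.gkzAssociahedron q)
        (Associahedra.hlAssociahedron σ)) ∧
    (∀ T₀ : Finset (Associahedra.Diagonal n), Associahedra.IsTriangulation T₀ →
      ¬ Associahedra.FansLinearlyIsomorphic
          (Associahedra.normalFan (Associahedra.gkzAssociahedron q))
          (Associahedra.santosFan T₀) ∧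
      ∀ (E : Type*) [AddCommGroup E] [Module ℝ E] (P : Set E),
        Associahedra.IsSantosAssociahedron T₀ P →
          ¬ Associahedra.NormallyIsomorphic (Associahedra.gkzAssociahedron q) P) := by
  have hgkz := Associahedra.not_hasOppositeRays_gkzAssociahedron hn hq
  refine ⟨?_, fun σ h => ?_, fun T₀ hT => ⟨fun h => ?_, fun E _ _ P hP h => ?_⟩⟩
  · rintro ⟨F, G, h⟩
    exact Associahedra.not_isParallelFacetPair_gkzAssociahedron hn hq F G h
  · exact hgkz (h.hasOppositeRays_iff.2 (Associahedra.hasOppositeRays_hlAssociahedron hn σ))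
  · exact hgkz (h.hasOppositeRays_iff.2 (hT.hasOppositeRays_santosFan (by omega)))
  -- Opposite rays pass from the fan of `T₀` to that of `P`, and from there to the secondary
  -- polytope.
  · exact hgkz (h.hasOppositeRays_iff.2
      (hP.2.hasOppositeRays_iff.2 (hT.hasOppositeRays_santosFan (by omega))))
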